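/- Let $h_n(x)=(2^n n!)^{-1/2}\pi^{-1/4}H_n(x)e^{-x^2/2}$ be the Hermite functions, write $|n\rangle=h_n\in L^2(\mathbb R)$, and let $\mathcal H^M=\mathrm{span}_{\mathbb C}\{|n\rangle:0\le n\le M\}$. Let $\mathcal H\subseteq\mathcal H^M$ be a complex linear subspace with $|0\rangle\in\mathcal H$ and $\dim\mathcal H=N+1$, where $N\ge 1$. Let $\mathcal D(\mathcal H)$ be the set of density matrices on $\mathcal H$ (positive self-adjoint operators $\mathcal H\to\mathcal H$ of trace $1$). For an operator $\rho$ on $\mathcal H$ with integral kernel $K_\rho$ let $$W\rho(x,\xi)=\frac1{2\pi}\int_{\mathbb R}e^{-i\xi y}K_\rho\Bigl(x+\frac y2,\,x-\frac y2\Bigr)\,dy$$ be its Wigner function (real-valued if $\rho$ is self-adjoint), and let $\mathcal D_+(\mathcal H)=\{\rho\in\mathcal D(\mathcal H): W\rho(z)\ge 0\ \text{for all } z\in\mathbb R^2\}$. Relative interior ($\mathrm{iint}$) and relative boundary ($\partial^i$) are taken in the affine hull of the set, and closures in the space of operators on $\mathcal H$, for the topology of the trace norm $\|A\|_1=\mathrm{tr}|A|$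 (on this finite-dimensional space every norm gives the same topology). For operators $u,v$ let $[u,v]=\{(1-t)u+tv: 0\le t\le 1\}$ and $(u,v)=[u,v]\setminus\{u,v\}$. Put $\rho_0=|0\rangle\langle 0|$ and $$Y(\mathcal H)=\{\rho\in\mathcal D(\mathcal H):\ \mathrm{Rank}\,\rho=N,\ |0\rangle\notin\mathrm{Ran}\,\rho\},$$ and for $\rho_1\in Y(\mathcal H)$ let $$k_0(\rho_1)=\min\Bigl(\{0\}\cup\Bigl\{\frac{W\rho_1(z)}{W\rho_0(z)}:z\in\mathbb R^2\Bigr\}\Bigr),\quad t_0(\rho_1)=\frac1{1-k_0(\rho_1)},\quad F(\rho_1)=(1-t_0(\rho_1))\rho_0+t_0(\rho_1)\rho_1 .$$ Let $X_+(\mathcal H)=F(Y(\mathcal H))$. Then: 1. For every $\rho_1\in Y(\mathcal H)$ the minimum $k_0(\rho_1)$ is attained. The map $F$ is injective on $Y(\mathcal H)$, takes values in $\partial^i\mathcal D_+(\mathcal H)$, and satisfies $t_0(\rho_1)=\|F(\rho_1)-\rho_0\|_1/\|\rho_1-\rho_0\|_1$ for every $\rho_1\in Y(\mathcal H)$. 2.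 For every $\rho\in\mathrm{iint}\,\mathcal D_+(\mathcal H)$ there is exactly one $\rho_1\in Y(\mathcal H)$ with $\rho\in(\rho_0,\rho_1)$ and exactly one $\rho_+\in\partial^i\mathcal D_+(\mathcal H)$ with $\rho\in(\rho_0,\rho_+)$; moreover $\rho_+=F(\rho_1)$. 3. $$\mathrm{iint}\,\mathcal D_+(\mathcal H)=\bigcup_{\rho_1\in Y(\mathcal H)}(\rho_0,F(\rho_1))=\bigcup_{\rho_+\in X_+(\mathcal H)}(\rho_0,\rho_+).$$ In both unions every segment is nonempty, the segments are pairwise disjoint, and each element of $\mathrm{iint}\,\mathcal D_+(\mathcal H)$ lies on exactly one of them (for exactly one $\rho_1\in Y(\mathcal H)$, respectively exactly one $\rho_+\in X_+(\mathcal H)$). 4. $$\mathcal D_+(\mathcal H)=\overline{\bigcup_{\rho_+\in X_+(\mathcal H)}(\rho_0,\rho_+)}.$$ -/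

import Mathlib

open MeasureTheory

noncomputable section

/-- The physicists' Hermite polynomials: `H_0 = 1` and `H_{n+1} = 2 X H_n - H_n'`. -/
def physHermite : ℕ → Polynomial ℝ
  | 0 => 1
  | n + 1 => 2 * Polynomial.X * physHermite n - Polynomial.derivative (physHermite n)

/-- The Hermite function `h_n(x) = (2^n n!)^{-1/2} π^{-1/4} H_n(x) e^{-x²/2}`. -/
def hermiteFun (n : ℕ) (x : ℝ) : ℝ :=
  ((2 : ℝ) ^ n * (n.factorial : ℝ)) ^ (-(1 / 2) : ℝ) * Real.pi ^ (-(1 / 4) : ℝ) *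
    (physHermite n).eval x * Real.exp (-(x ^ 2) / 2)

theorem integrable_poly_mul_gaussian (p : Polynomial ℝ) :
    Integrable (fun x : ℝ => p.eval x * Real.exp (-(x ^ 2))) := by
  induction p using Polynomial.induction_on' with
  | add p q hp hq =>
    have h := hp.add hq
    simp only [Polynomial.eval_add, add_mul]
    exact h
  | monomial n a =>
    have h := integrable_rpow_mul_exp_neg_mul_sq (b := 1) one_pos (s := (n : ℝ))
      (by have : (0 : ℝ) ≤ n := Nat.cast_nonneg n
          linarith)
    simp only [Real.rpow_natCast] at h
    simpa [mul_assoc] using h.const_mul a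

/-- The Hermite functions are square integrable. -/
theorem memLp_hermiteFun (n : ℕ) :
    MemLp (fun x : ℝ => (hermiteFun n x : ℂ)) 2 volume := by
  have hc : Continuous (fun x : ℝ => (hermiteFun n x : ℂ)) := by
    unfold hermiteFun
    fun_prop
  rw [memLp_two_iff_integrable_sq_norm hc.aestronglyMeasurable]
  have h := (integrable_poly_mul_gaussian (physHermite n ^ 2)).const_mul
    ((((2 : ℝ) ^ n * (n.factorial : ℝ)) ^ (-(1 / 2) : ℝ) * Real.pi ^ (-(1 / 4) : ℝ)) ^ 2)
  refine h.congr (Filter.Eventually.of_forall fun x => ?_)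
  have he : Real.exp (-(x ^ 2)) = Real.exp (-(x ^ 2) / 2) ^ 2 := by
    rw [← Real.exp_nat_mul]
    congr 1
    push_cast
    ring
  simp only [Complex.norm_real, Real.norm_eq_abs, sq_abs, Polynomial.eval_pow, he, hermiteFun]
  ring

/-- The trace norm `‖A‖₁ = tr |A|` of an operator on a finite-dimensional Hilbert space, where
`|A|` is the positive square root of `A† A`. -/
def traceNorm {E : Type*} [NormedAddCommGroup E] [InnerProductSpace ℂ E] [FiniteDimensional ℂ E]
    (A : E →L[ℂ] E) : ℝ :=
  haveI : CompleteSpace E := FiniteDimensional.complete ℂ E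
  (LinearMap.trace ℂ E (CFC.abs A : E →L[ℂ] E)).re

/-- The Hilbert space `L²(ℝ)` of complex-valued square-integrable functions. -/
abbrev L2R : Type := Lp ℂ 2 (volume : Measure ℝ)

/-- The Fock state `|n⟩`, that is, the Hermite function `h_n` as an element of `L²(ℝ)`. -/
def fock (n : ℕ) : L2R := (memLp_hermiteFun n).toLp _

/-- The space `ℋ^M = span {|n⟩ : 0 ≤ n ≤ M}`. -/
def fockSpace (M : ℕ) : Submodule ℂ L2R :=
  Submodule.span ℂ (fock '' Set.Iic M)

/-- The operators on a (finite-dimensional) subspace `H` of `L²(ℝ)`. As `H` is finite-dimensional,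
every operator is bounded and of trace class, and all norms on this space (in particular the
operator norm and the trace norm) induce the same topology. -/
def Op (H : Submodule ℂ L2R) : Type := H →L[ℂ] H

instance (H : Submodule ℂ L2R) : NormedAddCommGroup (Op H) :=
  inferInstanceAs (NormedAddCommGroup (H →L[ℂ] H))

/-- The complex normed space structure of the operators; the real one is its restriction. -/
instance (H : Submodule ℂ L2R) : NormedSpace ℂ (Op H) :=
  inferInstanceAs (NormedSpace ℂ (H →L[ℂ] H))

/-- An element of `Op H` as a continuous linear map. -/
def Op.toCLM {H : Submodule ℂ L2R} (ρ : Op H) : H →L[ℂ] H := ρ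

section

variable (H : Submodule ℂ L2R)

/-- `𝒟(ℋ)`: the density matrices, i.e. positive (hence self-adjoint) operators of unit trace. -/
def densityMatrices : Set (Op H) :=
  {ρ | ρ.toCLM.IsPositive ∧ LinearMap.trace ℂ H ρ.toCLM.toLinearMap = 1}

variable [FiniteDimensional ℂ H]

variable {H} in
/-- The integral kernel `K_ρ(x, y) = ∑ⱼ (ρ eⱼ)(x) conj(eⱼ(y))` of the operator `ρ` on `ℋ`, where
`(eⱼ)` is an orthonormal basis of `ℋ`. Up to null sets it does not depend on the basis. -/
def opKernel (ρ : Op H) (x y : ℝ) : ℂ :=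
  ∑ j, ((ρ.toCLM (stdOrthonormalBasis ℂ H j) : L2R) : ℝ → ℂ) x *
    (starRingEnd ℂ) (((stdOrthonormalBasis ℂ H j : H) : L2R) y)

variable {H} in
/-- The Wigner function
`Wρ(x, ξ) = (2π)⁻¹ ∫ e^{-iξy} K_ρ(x + y/2, x - y/2) dy` of the operator `ρ`, at `z = (x, ξ)`.
Changing the representatives of the `L²` functions in `K_ρ` does not change the integral, at any
point `z`. -/
def wignerC (ρ : Op H) (z : ℝ × ℝ) : ℂ :=
  1 / (2 * Real.pi) *
    ∫ y : ℝ, Complex.exp (-(Complex.I * z.2 * y)) * opKernel ρ (z.1 + y / 2) (z.1 - y / 2)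

variable {H} in
/-- The Wigner function of a self-adjoint operator, which is real-valued, as a real function. -/
def wigner (ρ : Op H) (z : ℝ × ℝ) : ℝ := (wignerC ρ z).re

/-- `𝒟₊(ℋ)`: the Wigner-positive states. -/
def wignerPositive : Set (Op H) :=
  {ρ | ρ ∈ densityMatrices H ∧ ∀ z : ℝ × ℝ, 0 ≤ wigner ρ z}

end

section

variable {H : Submodule ℂ L2R} (h0 : fock 0 ∈ H)

/-- The state `ρ₀ = |0⟩⟨0|`, as an operator on a space `ℋ` that contains `|0⟩`. -/
def rhoZero : Op H :=
  show H →L[ℂ] H from InnerProductSpace.rankOne ℂ (⟨fock 0, h0⟩ : H) (⟨fock 0, h0⟩ : H)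

/-- The set `Y(ℋ)` of density matrices of rank `N` whose range does not contain `|0⟩`; it is
used for `dim ℋ = N + 1`. -/
def generatorY (N : ℕ) : Set (Op H) :=
  {ρ | ρ ∈ densityMatrices H ∧ Module.finrank ℂ (LinearMap.range ρ.toCLM.toLinearMap) = N ∧
    (⟨fock 0, h0⟩ : H) ∉ LinearMap.range ρ.toCLM.toLinearMap}

variable [FiniteDimensional ℂ H]

/-- The set `{0} ∪ {Wρ₁(z) / Wρ₀(z) : z ∈ ℝ²}`. -/
def wignerRatios (ρ₁ : Op H) : Set ℝ :=
  insert 0 (Set.range fun z : ℝ × ℝ => wigner ρ₁ z / wigner (rhoZero h0) z)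

/-- `k₀(ρ₁) = min {0, Wρ₁(z) / Wρ₀(z) : z ∈ ℝ²}`, written as an infimum; it is a minimum for
every `ρ₁ ∈ Y(ℋ)`. -/
def kZero (ρ₁ : Op H) : ℝ := sInf (wignerRatios h0 ρ₁)

/-- `t₀(ρ₁) = 1 / (1 - k₀(ρ₁))`. -/
def tZero (ρ₁ : Op H) : ℝ := 1 / (1 - kZero h0 ρ₁)

/-- `F(ρ₁) = (1 - t₀(ρ₁)) ρ₀ + t₀(ρ₁) ρ₁`. -/
def mapF (ρ₁ : Op H) : Op H :=
  (1 - tZero h0 ρ₁) • rhoZero h0 + tZero h0 ρ₁ • ρ₁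

/-- `X₊(ℋ) = Ran F`, the image of `Y(ℋ)` under `F`. -/
def generatorX (N : ℕ) : Set (Op H) := mapF h0 '' generatorY h0 N

end

/-- The open segment `(u, v) = [u, v] \ {u, v}`, which is empty if `u = v`. -/
def openSeg {E : Type*} [AddCommGroup E] [Module ℝ E] (u v : E) : Set E :=
  segment ℝ u v \ {u, v}

end

/-!
# Wigner-positive states as a union of segments that start at the vacuum

Every element of `ℋ` is a polynomial times `e^{-x²/2}`, so the Wigner function of an operator `σ`
on `ℋ`, divided by the Gaussian `Wρ₀`, is a polynomial `r_σ` on phase space. Everything depends on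
its behaviour at infinity. Let `m` be the maximal degree of the polynomials in `ℋ`, and let `v ∈ ℋ`
represent the functional that takes the coefficient of degree `m`, up to normalization. At
`ζ = x + iξ`, one has `r_σ(ζ) = ⟨v, σ v⟩ |ζ|^{2m}` up to terms of degree below `2m`
(`exists_wignerQuotient`). This follows from a recurrence for the integrals of
`(x + y/2)^a (x - y/2)^b e^{-y²/4 - iξy}` over `y`, which integration by parts provides
(`wignerMoment_succ_left`, `normMoment_asymptotics`). Since `dim ℋ ≥ 2`, `m` is positive, so `v` is
orthogonal to the vacuum.

If `ρ` is an invertible state and `r_ρ` is bounded away from zero, then `r_ρ` grows like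
`(1 + |ζ|)^{2m}`, because `⟨v, ρ v⟩ > 0`. As `r_σ` is of order `‖σ‖ (1 + |ζ|)^{2m}` for all `σ`
(`WignerQuotient.exists_abs_le_norm`), the states near `ρ` are Wigner-positive. Such states `ρ`
form the relative interior (`WignerQuotient.intrinsicInterior_eq`); conversely, a point of the
relative interior lies strictly between a state of this kind and another Wigner-positive state.

For `ρ₁ ∈ Y(ℋ)` the kernel of `ρ₁` is a line that is not orthogonal to the vacuum, while `v` is, so
`⟨v, ρ₁ v⟩ > 0` as well. Hence `r_{ρ₁}` is nonnegative outside a compact set, and `k₀` is attained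
(`WignerQuotient.exists_isLeast`). On the ray from `ρ₀` to `ρ₁` the states are invertible before
`ρ₁`, and their quotients are bounded away from zero before `F(ρ₁)`. Conversely, an invertible
state `ρ` has a largest `l` with `ρ - l ρ₀ ≥ 0`, namely `l = 1 / ⟨0, ρ⁻¹ 0⟩`, and the difference
is a multiple of an element of `Y(ℋ)` (`exists_sub_smul_rankOne`). So the rays to `Y(ℋ)` cover the
relative interior. They meet only in `ρ₀`, since a point of such a ray before its end point is
invertible (`ray_unique`).
-/

open MeasureTheory

noncomputable section

/-! ### Moments of the Gaussian in phase space -/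

/-- The point `x + iξ` of the complex plane that corresponds to the point `(x, ξ)` of phase space. -/
def phasePoint (z : ℝ × ℝ) : ℂ := (z.1 : ℂ) + Complex.I * z.2

@[fun_prop]
lemma continuous_phasePoint : Continuous phasePoint := by
  unfold phasePoint
  fun_prop

/-- The continuous functions on phase space that grow at most like a polynomial of degree `n`. -/
def polyGrowth (n : ℕ) : Submodule ℂ (ℝ × ℝ → ℂ) where
  carrier := {f | Continuous f ∧ ∃ C : ℝ, ∀ z, ‖f z‖ ≤ C * (1 + ‖phasePoint z‖) ^ n}
  add_mem' := by
    rintro f g ⟨hf, C, hC⟩ ⟨hg, D, hD⟩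
    refine ⟨hf.add hg, C + D, fun z => ?_⟩
    rw [add_mul]
    exact (norm_add_le _ _).trans (add_le_add (hC z) (hD z))
  zero_mem' := ⟨continuous_const, 0, fun z => by simp⟩
  smul_mem' := by
    rintro c f ⟨hf, C, hC⟩
    refine ⟨hf.const_smul c, ‖c‖ * C, fun z => ?_⟩
    rw [Pi.smul_apply, norm_smul, mul_assoc]
    exact mul_le_mul_of_nonneg_left (hC z) (norm_nonneg c)

lemma polyGrowth_mono {m n : ℕ} (h : m ≤ n) : polyGrowth m ≤ polyGrowth n := by
  rintro f ⟨hf, C, hC⟩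
  refine ⟨hf, C, fun z => (hC z).trans ?_⟩
  have h1 : 1 ≤ 1 + ‖phasePoint z‖ := by simp
  have hC0 : 0 ≤ C :=
    nonneg_of_mul_nonneg_left ((norm_nonneg _).trans (hC z)) (by positivity)
  exact mul_le_mul_of_nonneg_left (pow_le_pow_right₀ h1 h) hC0

lemma mul_mem_polyGrowth {m n : ℕ} {f g : ℝ × ℝ → ℂ} (hf : f ∈ polyGrowth m)
    (hg : g ∈ polyGrowth n) : f * g ∈ polyGrowth (m + n) := by
  obtain ⟨hf, C, hC⟩ := hf
  obtain ⟨hg, D, hD⟩ := hg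
  refine ⟨hf.mul hg, C * D, fun z => ?_⟩
  rw [Pi.mul_apply, norm_mul, pow_add, mul_mul_mul_comm]
  exact mul_le_mul (hC z) (hD z) (norm_nonneg _) ((norm_nonneg _).trans (hC z))

lemma phasePoint_mem_polyGrowth : phasePoint ∈ polyGrowth 1 :=
  ⟨continuous_phasePoint, 1, fun z => by simp⟩

lemma conj_phasePoint_mem_polyGrowth : star phasePoint ∈ polyGrowth 1 :=
  ⟨continuous_phasePoint.star, 1, fun z => by simp⟩

lemma one_mem_polyGrowth : (1 : ℝ × ℝ → ℂ) ∈ polyGrowth 0 :=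
  ⟨continuous_const, 1, fun z => by simp⟩

lemma pow_mem_polyGrowth {f : ℝ × ℝ → ℂ} (hf : f ∈ polyGrowth 1) (n : ℕ) :
    f ^ n ∈ polyGrowth n := by
  induction n with
  | zero => simpa using one_mem_polyGrowth
  | succ n ih => rw [pow_succ]; exact mul_mem_polyGrowth ih hf

/-- The integrand of the Wigner transform of two monomials times Gaussians, after a factor that
depends on `x` only has been taken out. -/
def wignerIntegrand (a b : ℕ) (z : ℝ × ℝ) (y : ℝ) : ℂ :=
  ((z.1 : ℂ) + y / 2) ^ a * ((z.1 : ℂ) - y / 2) ^ b *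
    Complex.exp (-(y : ℂ) ^ 2 / 4 - Complex.I * z.2 * y)

lemma integrable_pow_mul_cexp (n : ℕ) (ξ : ℝ) :
    Integrable (fun y : ℝ => (y : ℂ) ^ n * Complex.exp (-(y : ℂ) ^ 2 / 4 - Complex.I * ξ * y)) := by
  have h := integrable_rpow_mul_exp_neg_mul_sq (b := 1 / 4) (by norm_num) (s := (n : ℝ))
    (by have : (0 : ℝ) ≤ n := Nat.cast_nonneg n
        linarith)
  simp only [Real.rpow_natCast] at h
  refine h.norm.mono' (by fun_prop) (Filter.Eventually.of_forall fun y => ?_)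
  rw [norm_mul, norm_mul, Complex.norm_exp, norm_pow, norm_pow, Complex.norm_real,
    Real.norm_of_nonneg (Real.exp_pos _).le]
  gcongr
  have : (-(y : ℂ) ^ 2 / 4 - Complex.I * ξ * y).re = -(1 / 4) * y ^ 2 := by
    have : (-(y : ℂ) ^ 2 / 4 - Complex.I * ξ * y) =
      ((-(1 / 4) * y ^ 2 : ℝ) : ℂ) + ((-(ξ * y) : ℝ) : ℂ) * Complex.I := by push_cast; ring
    rw [this]; simp [-Complex.ofReal_mul, -Complex.ofReal_neg]
  rw [this]

lemma integrable_wignerIntegrand (a b : ℕ) (z : ℝ × ℝ) : Integrable (wignerIntegrand a b z) := by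
  have key (p : Polynomial ℂ) : Integrable (fun y : ℝ => p.eval (y : ℂ) *
      Complex.exp (-(y : ℂ) ^ 2 / 4 - Complex.I * z.2 * y)) := by
    induction p using Polynomial.induction_on' with
    | add p q hp hq =>
      simp only [Polynomial.eval_add, add_mul]
      exact hp.add hq
    | monomial n c =>
      simpa [mul_assoc] using (integrable_pow_mul_cexp n z.2).const_mul c
  refine (key ((Polynomial.C (z.1 : ℂ) + Polynomial.C (1 / 2) * Polynomial.X) ^ a *
    (Polynomial.C (z.1 : ℂ) - Polynomial.C (1 / 2) * Polynomial.X) ^ b)).congr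
    (Filter.Eventually.of_forall fun y => ?_)
  simp [wignerIntegrand]
  congr 2 <;> ring

/-- The Wigner transform of the monomials `X ^ a` and `X ^ b` times Gaussians, up to a factor
that depends on `x` only. -/
def wignerMoment (a b : ℕ) (z : ℝ × ℝ) : ℂ := ∫ y, wignerIntegrand a b z y

lemma wignerMoment_zero_zero (z : ℝ × ℝ) :
    wignerMoment 0 0 z = ((2 * √Real.pi * Real.exp (-z.2 ^ 2) : ℝ) : ℂ) := by
  have h := fourierIntegral_gaussian (b := 1 / 4) (by norm_num) (-z.2 : ℂ)
  have h2 : ((Real.pi : ℂ) / (1 / 4)) ^ (1 / 2 : ℂ) = ((2 * √Real.pi : ℝ) : ℂ) := by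
    have e : ((Real.pi : ℂ) / (1 / 4)) = ((4 * Real.pi : ℝ) : ℂ) := by push_cast; ring
    have e2 : (1 / 2 : ℂ) = ((1 / 2 : ℝ) : ℂ) := by push_cast; ring
    rw [e, e2, ← Complex.ofReal_cpow (by positivity), ← Real.sqrt_eq_rpow,
      Real.sqrt_mul (by norm_num)]
    congr 2
    rw [show (4 : ℝ) = 2 ^ 2 by norm_num, Real.sqrt_sq (by norm_num)]
  rw [h2] at h
  unfold wignerMoment wignerIntegrand
  rw [Complex.ofReal_mul, Complex.ofReal_exp]
  convert h using 2
  · ext y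
    rw [← Complex.exp_add]
    simp only [pow_zero, one_mul]
    congr 1
    ring
  · push_cast
    congr 1
    ring

lemma wignerMoment_add_succ (a b : ℕ) (z : ℝ × ℝ) :
    wignerMoment (a + 1) b z + wignerMoment a (b + 1) z = 2 * z.1 * wignerMoment a b z := by
  unfold wignerMoment
  rw [← integral_add (integrable_wignerIntegrand _ _ _) (integrable_wignerIntegrand _ _ _),
    ← integral_const_mul]
  refine integral_congr_ae (Filter.Eventually.of_forall fun y => ?_)
  simp only [wignerIntegrand, pow_succ]
  ring

/-- Integration by parts of the derivative of the integrand of `wignerMoment a b`. -/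
lemma wignerMoment_succ_left (a b : ℕ) (z : ℝ × ℝ) :
    wignerMoment (a + 1) b z = star (phasePoint z) * wignerMoment a b z +
      a / 2 * wignerMoment (a - 1) b z - b / 2 * wignerMoment a (b - 1) z := by
  have hd (y : ℝ) : HasDerivAt (wignerIntegrand a b z)
      (a / 2 * wignerIntegrand (a - 1) b z y - b / 2 * wignerIntegrand a (b - 1) z y
        + star (phasePoint z) * wignerIntegrand a b z y - wignerIntegrand (a + 1) b z y) y := by
    have hy : HasDerivAt (fun y : ℝ => (y : ℂ)) 1 y := Complex.ofRealCLM.hasDerivAt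
    have h1 : HasDerivAt (fun y : ℝ => (z.1 : ℂ) + y / 2) (1 / 2) y := (hy.div_const 2).const_add _
    have h2 : HasDerivAt (fun y : ℝ => (z.1 : ℂ) - y / 2) (-(1 / 2)) y :=
      (hy.div_const 2).const_sub _
    have h3 := (((hy.pow 2).neg.div_const 4).sub (hy.const_mul (Complex.I * z.2))).cexp
    refine (((h1.pow a).mul (h2.pow b)).mul h3).congr_deriv ?_
    simp only [wignerIntegrand, phasePoint, pow_succ, Pi.pow_apply, Pi.mul_apply, Pi.neg_apply,
      Pi.sub_apply, RCLike.star_def, map_add, map_mul, Complex.conj_ofReal, Complex.conj_I]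
    push_cast
    simp
    ring
  have hi (a b : ℕ) := integrable_wignerIntegrand a b z
  have i1 : Integrable fun y => (a / 2 : ℂ) * wignerIntegrand (a - 1) b z y := (hi _ _).const_mul _
  have i2 : Integrable fun y => (b / 2 : ℂ) * wignerIntegrand a (b - 1) z y := (hi _ _).const_mul _
  have i3 : Integrable fun y => star (phasePoint z) * wignerIntegrand a b z y :=
    (hi _ _).const_mul _
  have i12 : Integrable fun y => (a / 2 : ℂ) * wignerIntegrand (a - 1) b z y -
    (b / 2 : ℂ) * wignerIntegrand a (b - 1) z y := i1.sub i2
  have i123 : Integrable fun y => (a / 2 : ℂ) * wignerIntegrand (a - 1) b z y -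
    (b / 2 : ℂ) * wignerIntegrand a (b - 1) z y + star (phasePoint z) * wignerIntegrand a b z y :=
    i12.add i3
  have h0 := integral_eq_zero_of_hasDerivAt_of_integrable hd (i123.sub (hi (a + 1) b)) (hi a b)
  rw [integral_sub i123 (hi (a + 1) b), integral_add i12 i3, integral_sub i1 i2,
    integral_const_mul, integral_const_mul, integral_const_mul] at h0
  unfold wignerMoment
  linear_combination -h0

/-- The quotient of `wignerMoment a b` by its value for `a = b = 0`. It is in fact a polynomial
in `(x, ξ)`. -/
def normMoment (a b : ℕ) (z : ℝ × ℝ) : ℂ := wignerMoment a b z / wignerMoment 0 0 z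

lemma wignerMoment_zero_zero_ne (z : ℝ × ℝ) : wignerMoment 0 0 z ≠ 0 := by
  rw [wignerMoment_zero_zero]
  have := Real.pi_pos
  exact_mod_cast (by positivity : (0 : ℝ) < 2 * √Real.pi * Real.exp (-z.2 ^ 2)).ne'

lemma normMoment_zero_zero : normMoment 0 0 = 1 := by
  ext z
  exact div_self (wignerMoment_zero_zero_ne z)

lemma normMoment_succ_left (a b : ℕ) : normMoment (a + 1) b = star phasePoint * normMoment a b +
      ((a / 2 : ℂ) • normMoment (a - 1) b - (b / 2 : ℂ) • normMoment a (b - 1)) := by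
  ext z
  simp only [normMoment, wignerMoment_succ_left a b z, Pi.add_apply, Pi.mul_apply, Pi.star_apply,
    Pi.sub_apply, Pi.smul_apply, smul_eq_mul]
  ring

lemma normMoment_succ_right (a b : ℕ) : normMoment a (b + 1) = phasePoint * normMoment a b -
      ((a / 2 : ℂ) • normMoment (a - 1) b - (b / 2 : ℂ) • normMoment a (b - 1)) := by
  ext z
  have h := wignerMoment_add_succ a b z
  rw [← eq_sub_iff_add_eq'] at h
  simp only [normMoment, h, wignerMoment_succ_left a b z, Pi.mul_apply, Pi.sub_apply,
    Pi.smul_apply, smul_eq_mul, phasePoint, RCLike.star_def, map_add, map_mul,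
    Complex.conj_ofReal, Complex.conj_I]
  ring

/-- The normalized moment is `conj ζ ^ a * ζ ^ b` up to terms of lower degree, at `ζ = x + iξ`.
For `n = 0` the difference vanishes, so the truncated subtraction in `n - 1` does no harm. -/
theorem normMoment_asymptotics (n : ℕ) : ∀ a b : ℕ, a + b = n → normMoment a b ∈ polyGrowth n ∧
    normMoment a b - star phasePoint ^ a * phasePoint ^ b ∈ polyGrowth (n - 1) := by
  induction n using Nat.strong_induction_on with
  | _ n ih =>
  intro a b hab
  suffices h : normMoment a b - star phasePoint ^ a * phasePoint ^ b ∈ polyGrowth (n - 1) by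
    refine ⟨?_, h⟩
    rw [← sub_add_cancel (normMoment a b) (star phasePoint ^ a * phasePoint ^ b)]
    refine add_mem (polyGrowth_mono (Nat.sub_le n 1) h) ?_
    rw [← hab]
    exact mul_mem_polyGrowth (pow_mem_polyGrowth conj_phasePoint_mem_polyGrowth a)
      (pow_mem_polyGrowth phasePoint_mem_polyGrowth b)
  -- the terms of lower degree in the recurrences
  have low (a b : ℕ) (hn : n = a + b + 1) :
      ((a / 2 : ℂ) • normMoment (a - 1) b - (b / 2 : ℂ) • normMoment a (b - 1)) ∈
        polyGrowth (n - 1) := by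
    refine sub_mem ?_ ?_
    · rcases a with _ | a
      · simp
      · exact Submodule.smul_mem _ _ (polyGrowth_mono (by omega)
          (ih (a + b) (by omega) a b rfl).1)
    · rcases b with _ | b
      · simp
      · exact Submodule.smul_mem _ _ (polyGrowth_mono (by omega)
          (ih (a + b) (by omega) a b rfl).1)
  -- multiplication by a function of degree one
  have top (g : ℝ × ℝ → ℂ) (hg : g ∈ polyGrowth 1) (a b : ℕ) (hn : n = a + b + 1) :
      g * (normMoment a b - star phasePoint ^ a * phasePoint ^ b) ∈ polyGrowth (n - 1) := by
    rcases Nat.eq_zero_or_pos (a + b) with h | h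
    · obtain ⟨rfl, rfl⟩ : a = 0 ∧ b = 0 := by omega
      simp [normMoment_zero_zero]
    · exact polyGrowth_mono (by omega) (mul_mem_polyGrowth hg (ih (a + b) (by omega) a b rfl).2)
  rcases a with _ | a
  · rcases b with _ | b
    · simp [normMoment_zero_zero]
    · convert sub_mem (top _ phasePoint_mem_polyGrowth 0 b (by omega)) (low 0 b (by omega)) using 1
      rw [normMoment_succ_right]
      ring
  · convert add_mem (top _ conj_phasePoint_mem_polyGrowth a b (by omega)) (low a b (by omega))
      using 1
    rw [normMoment_succ_left]
    ring

/-! ### Hermite functions as polynomials times Gaussians -/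

/-- The function `p(x) e^{-x²/2}`. -/
def gaussFun (p : Polynomial ℂ) (x : ℝ) : ℂ := p.eval (x : ℂ) * Complex.exp (-(x : ℂ) ^ 2 / 2)

lemma continuous_gaussFun (p : Polynomial ℂ) : Continuous (gaussFun p) := by
  unfold gaussFun
  fun_prop

lemma memLp_gaussFun (p : Polynomial ℂ) : MemLp (gaussFun p) 2 volume := by
  induction p using Polynomial.induction_on' with
  | add p q hp hq =>
    convert hp.add hq using 1
    ext x
    simp [gaussFun, add_mul]
  | monomial n c =>
    rw [memLp_two_iff_integrable_sq_norm (continuous_gaussFun _).aestronglyMeasurable]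
    have h := integrable_poly_mul_gaussian (Polynomial.monomial (2 * n) (‖c‖ ^ 2))
    refine h.congr (Filter.Eventually.of_forall fun x => ?_)
    have he : (-(x : ℂ) ^ 2 / 2) = ((-x ^ 2 / 2 : ℝ) : ℂ) := by push_cast; ring
    have he' : Real.exp (-(x ^ 2)) = Real.exp (-x ^ 2 / 2) ^ 2 := by
      rw [← Real.exp_nat_mul]
      congr 1
      push_cast
      ring
    simp only [gaussFun, Polynomial.eval_monomial, he, norm_mul, Complex.norm_exp_ofReal, norm_pow,
      Complex.norm_real, mul_pow, he', Real.norm_eq_abs]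
    rw [← pow_mul, mul_comm n 2, pow_mul |x|, sq_abs, pow_mul]

/-- The linear map that sends a polynomial `p` to the element `p(x) e^{-x²/2}` of `L²(ℝ)`. -/
def gaussPoly : Polynomial ℂ →ₗ[ℂ] L2R where
  toFun p := (memLp_gaussFun p).toLp _
  map_add' p q := by
    rw [← MemLp.toLp_add]
    congr 1
    ext x
    simp [gaussFun, add_mul]
  map_smul' c p := by
    rw [RingHom.id_apply, ← MemLp.toLp_const_smul]
    congr 1
    ext x
    simp [gaussFun, mul_assoc]

lemma coeFn_gaussPoly (p : Polynomial ℂ) : (gaussPoly p : ℝ → ℂ) =ᵐ[volume] gaussFun p :=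
  (memLp_gaussFun p).coeFn_toLp

lemma gaussPoly_injective : Function.Injective gaussPoly := by
  intro p q h
  have h1 : gaussFun p =ᵐ[volume] gaussFun q :=
    (coeFn_gaussPoly p).symm.trans (h ▸ coeFn_gaussPoly q)
  have h2 := (Continuous.ae_eq_iff_eq volume (continuous_gaussFun p) (continuous_gaussFun q)).1 h1
  refine Polynomial.eq_of_infinite_eval_eq p q
    ((Set.infinite_range_of_injective Complex.ofReal_injective).mono ?_)
  rintro _ ⟨x, rfl⟩
  exact mul_right_cancel₀ (Complex.exp_ne_zero _) (congrFun h2 x)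

/-- The normalization constant of the Hermite function `h_n`. -/
def hermiteConst (n : ℕ) : ℝ :=
  ((2 : ℝ) ^ n * (n.factorial : ℝ)) ^ (-(1 / 2) : ℝ) * Real.pi ^ (-(1 / 4) : ℝ)

lemma fock_eq_gaussPoly (n : ℕ) : fock n =
    gaussPoly (Polynomial.C (hermiteConst n : ℂ) * (physHermite n).map Complex.ofRealHom) := by
  unfold fock gaussPoly
  simp only [LinearMap.coe_mk, AddHom.coe_mk]
  congr 1
  ext x
  have : (Polynomial.map Complex.ofRealHom (physHermite n)).eval (x : ℂ) =
      (((physHermite n).eval x : ℝ) : ℂ) := by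
    rw [Polynomial.eval_map]
    exact Polynomial.eval₂_at_apply Complex.ofRealHom x
  simp only [hermiteFun, gaussFun, hermiteConst, Polynomial.eval_mul, Polynomial.eval_C, this]
  push_cast
  ring

lemma fockSpace_le_range (M : ℕ) : fockSpace M ≤ LinearMap.range gaussPoly := by
  refine Submodule.span_le.2 ?_
  rintro _ ⟨n, -, rfl⟩
  exact ⟨_, (fock_eq_gaussPoly n).symm⟩

lemma hermiteConst_zero : hermiteConst 0 = Real.pi ^ (-(1 / 4) : ℝ) := by
  simp [hermiteConst]

lemma hermiteConst_zero_pos : 0 < hermiteConst 0 := by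
  rw [hermiteConst_zero]
  exact Real.rpow_pos_of_pos Real.pi_pos _

lemma fock_zero_eq : fock 0 = gaussPoly (Polynomial.C (hermiteConst 0 : ℂ)) := by
  simp [fock_eq_gaussPoly, physHermite]

lemma norm_fock_zero : ‖fock 0‖ = 1 := by
  have h : (inner ℂ (fock 0) (fock 0) : ℂ) = 1 := by
    rw [L2.inner_def]
    have : (fun x => inner ℂ ((fock 0 : ℝ → ℂ) x) ((fock 0 : ℝ → ℂ) x)) =ᵐ[volume]
        fun x : ℝ => (((hermiteConst 0) ^ 2 * Real.exp (-1 * x ^ 2) : ℝ) : ℂ) := by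
      rw [fock_zero_eq]
      filter_upwards [coeFn_gaussPoly (Polynomial.C (hermiteConst 0 : ℂ))] with x hx
      have he : (-(x : ℂ) ^ 2 / 2) = ((-x ^ 2 / 2 : ℝ) : ℂ) := by push_cast; ring
      rw [hx, inner_self_eq_norm_sq_to_K]
      simp only [gaussFun, Polynomial.eval_C, norm_mul, he, Complex.norm_exp_ofReal,
        Complex.norm_real, Real.norm_eq_abs, Complex.coe_algebraMap]
      rw [← Complex.ofReal_pow, mul_pow, sq_abs, ← Real.exp_nat_mul]
      congr 3
      push_cast
      ring
    rw [integral_congr_ae this, integral_complex_ofReal, integral_const_mul, integral_gaussian,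
      hermiteConst_zero, ← Real.rpow_natCast, ← Real.rpow_mul Real.pi_pos.le, div_one,
      Real.sqrt_eq_rpow, ← Real.rpow_add Real.pi_pos]
    norm_num
  have h2 := inner_self_eq_norm_sq_to_K (𝕜 := ℂ) (fock 0)
  rw [h] at h2
  have h3 : ‖fock 0‖ ^ 2 = 1 := by
    refine Complex.ofReal_injective ?_
    rw [Complex.ofReal_pow, Complex.ofReal_one]
    exact h2.symm
  exact (pow_eq_one_iff_of_nonneg (norm_nonneg _) two_ne_zero).1 h3

/-- The inner product of `L²(ℝ)` on a subspace. Without this shortcut, instance search finds the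
inner product of the structure of Hilbert `C⋆`-module over `ℂ`, to which the lemmas on inner product
spaces do not apply. -/
instance innerSubspace (H : Submodule ℂ L2R) : Inner ℂ H := InnerProductSpace.toInner

section

variable {H : Submodule ℂ L2R}

/-- `inner_smul_right` for the scalar multiplication that `H` has as a submodule. -/
lemma subspace_inner_smul_right (x y : H) (c : ℂ) :
    (inner ℂ x (c • y) : ℂ) = c * inner ℂ x y := inner_smul_right x y c

/-- `inner_smul_left` for the scalar multiplication that `H` has as a submodule. -/
lemma subspace_inner_smul_left (x y : H) (c : ℂ) :
    (inner ℂ (c • x) y : ℂ) = star c * inner ℂ x y := inner_smul_left x y c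

/-- Every element of a subspace of `span {|n⟩}` is a polynomial times `e^{-x²/2}`, and the
polynomial depends linearly on it. -/
lemma exists_polynomial_map {M : ℕ} (hHM : H ≤ fockSpace M) :
    ∃ P : H →ₗ[ℂ] Polynomial ℂ, ∀ f : H, gaussPoly (P f) = f := by
  let e := LinearEquiv.ofInjective gaussPoly gaussPoly_injective
  refine ⟨e.symm.toLinearMap ∘ₗ Submodule.inclusion (hHM.trans (fockSpace_le_range M)),
    fun f => ?_⟩
  exact congrArg Subtype.val
    (e.apply_symm_apply (Submodule.inclusion (hHM.trans (fockSpace_le_range M)) f))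

lemma quasiMeasurePreserving_affine (x : ℝ) {r : ℝ} (hr : r ≠ 0) :
    Measure.QuasiMeasurePreserving (fun y : ℝ => x + r * y) volume volume :=
  (measurePreserving_add_left volume x).quasiMeasurePreserving.comp
    (Measure.quasiMeasurePreserving_smul volume hr)

end

/-! ### Asymptotics of Wigner functions -/

section

variable {H : Submodule ℂ L2R}

/-- A product `f(x + y/2) conj(g(x - y/2))` of a polynomial times a Gaussian with another one,
expanded in the integrands of the moments. -/
lemma gaussFun_mul_conj_gaussFun (p q : Polynomial ℂ) (m : ℕ) (hp : p.natDegree ≤ m)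
    (hq : q.natDegree ≤ m) (z : ℝ × ℝ) (y : ℝ) :
    Complex.exp (-(Complex.I * z.2 * y)) *
      (gaussFun p (z.1 + y / 2) * star (gaussFun q (z.1 - y / 2))) =
    ∑ a ∈ Finset.range (m + 1), ∑ b ∈ Finset.range (m + 1),
      Complex.exp (-(z.1 : ℂ) ^ 2) * (p.coeff a * star (q.coeff b)) * wignerIntegrand a b z y := by
  have hexp : Complex.exp (-(Complex.I * z.2 * y)) *
      (Complex.exp (-((z.1 : ℂ) + y / 2) ^ 2 / 2) * Complex.exp (-((z.1 : ℂ) - y / 2) ^ 2 / 2)) =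
      Complex.exp (-(z.1 : ℂ) ^ 2) * Complex.exp (-(y : ℂ) ^ 2 / 4 - Complex.I * z.2 * y) := by
    rw [← Complex.exp_add, ← Complex.exp_add, ← Complex.exp_add]
    congr 1
    ring
  simp only [gaussFun, star_mul', Polynomial.eval_eq_sum_range' (Nat.lt_succ_of_le hp),
    Polynomial.eval_eq_sum_range' (Nat.lt_succ_of_le hq), star_sum, RCLike.star_def,
    ← Complex.exp_conj, map_pow, map_div₀, map_neg, Complex.conj_ofReal, map_ofNat]
  push_cast
  rw [mul_mul_mul_comm, Finset.sum_mul_sum, mul_left_comm, hexp, Finset.sum_mul]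
  refine Finset.sum_congr rfl fun a _ => ?_
  rw [Finset.sum_mul]
  refine Finset.sum_congr rfl fun b _ => ?_
  simp only [wignerIntegrand]
  ring

variable [FiniteDimensional ℂ H]

/-- The Wigner function of an operator is a combination of the moments. The coefficient of the
moment of order `(a, b)` is a matrix element of the operator, between the Riesz vectors `v a` and
`v b` of the coefficient functionals. -/
lemma wignerC_eq_sum {P : H →ₗ[ℂ] Polynomial ℂ} (hP : ∀ f : H, gaussPoly (P f) = f) {m : ℕ}
    (hm : ∀ f, (P f).natDegree ≤ m) {v : ℕ → H}
    (hv : ∀ a f, (inner ℂ (v a) f : ℂ) = (P f).coeff a) (σ : Op H) (z : ℝ × ℝ) :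
    wignerC σ z = 1 / (2 * Real.pi) * (Complex.exp (-(z.1 : ℂ) ^ 2) *
      ∑ a ∈ Finset.range (m + 1), ∑ b ∈ Finset.range (m + 1),
        inner ℂ (v a) (σ.toCLM (v b)) * wignerMoment a b z) := by
  let e := stdOrthonormalBasis ℂ H
  have hf (f : H) : ((f : L2R) : ℝ → ℂ) =ᵐ[volume] gaussFun (P f) := by
    conv_lhs => rw [← hP f]
    exact coeFn_gaussPoly _
  have hae : (fun y : ℝ => Complex.exp (-(Complex.I * z.2 * y)) *
      opKernel σ (z.1 + y / 2) (z.1 - y / 2)) =ᵐ[volume] fun y : ℝ =>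
      ∑ a ∈ Finset.range (m + 1), ∑ b ∈ Finset.range (m + 1),
        Complex.exp (-(z.1 : ℂ) ^ 2) * inner ℂ (v a) (σ.toCLM (v b)) *
          wignerIntegrand a b z y := by
    have h1 : ∀ᵐ y : ℝ, ∀ j, ((σ.toCLM (e j) : L2R) : ℝ → ℂ) (z.1 + 1 / 2 * y) =
        gaussFun (P (σ.toCLM (e j))) (z.1 + 1 / 2 * y) := ae_all_iff.2 fun j =>
      (quasiMeasurePreserving_affine z.1 (by norm_num : (1 / 2 : ℝ) ≠ 0)).ae (hf _)
    have h2 : ∀ᵐ y : ℝ, ∀ j, ((e j : L2R) : ℝ → ℂ) (z.1 + -(1 / 2) * y) =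
        gaussFun (P (e j)) (z.1 + -(1 / 2) * y) := ae_all_iff.2 fun j =>
      (quasiMeasurePreserving_affine z.1 (by norm_num : (-(1 / 2) : ℝ) ≠ 0)).ae (hf _)
    filter_upwards [h1, h2] with y hy1 hy2
    have e1 : z.1 + 1 / 2 * y = z.1 + y / 2 := by ring
    have e2 : z.1 + -(1 / 2) * y = z.1 - y / 2 := by ring
    rw [e1] at hy1
    rw [e2] at hy2
    have hsum (a b : ℕ) : ∑ j, (P (σ.toCLM (e j))).coeff a * star ((P (e j)).coeff b) =
        inner ℂ (v a) (σ.toCLM (v b)) := by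
      have hexpand : v b = ∑ j, inner ℂ (e j) (v b) • e j := (e.sum_repr' (v b)).symm
      conv_rhs => rw [hexpand, map_sum, inner_sum]
      refine Finset.sum_congr rfl fun j _ => ?_
      rw [map_smul, subspace_inner_smul_right, ← hv, ← hv, RCLike.star_def, inner_conj_symm, mul_comm]
    unfold opKernel
    rw [Finset.mul_sum]
    calc _ = ∑ j, ∑ a ∈ Finset.range (m + 1), ∑ b ∈ Finset.range (m + 1),
        Complex.exp (-(z.1 : ℂ) ^ 2) * ((P (σ.toCLM (e j))).coeff a *
          star ((P (e j)).coeff b)) * wignerIntegrand a b z y := by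
          refine Finset.sum_congr rfl fun j _ => ?_
          rw [← gaussFun_mul_conj_gaussFun _ _ m (hm _) (hm _), ← hy1, ← hy2]
          rfl
      _ = _ := by
          rw [Finset.sum_comm]
          refine Finset.sum_congr rfl fun a _ => ?_
          rw [Finset.sum_comm]
          refine Finset.sum_congr rfl fun b _ => ?_
          rw [← Finset.sum_mul, ← Finset.mul_sum, hsum]
  have hint (a b : ℕ) : Integrable (fun y => Complex.exp (-(z.1 : ℂ) ^ 2) *
      inner ℂ (v a) (σ.toCLM (v b)) * wignerIntegrand a b z y) :=
    (integrable_wignerIntegrand a b z).const_mul _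
  unfold wignerC
  rw [integral_congr_ae hae, integral_finsetSum _ fun a _ => integrable_finsetSum _ fun b _ =>
    hint a b]
  congr 1
  rw [Finset.mul_sum]
  refine Finset.sum_congr rfl fun a _ => ?_
  rw [integral_finsetSum _ fun b _ => hint a b, Finset.mul_sum]
  refine Finset.sum_congr rfl fun b _ => ?_
  rw [integral_const_mul, mul_assoc]
  rfl

/-- The vectors `v a` that represent the coefficient functionals of a subspace of `span {|n⟩}`, up
to the maximal degree `m`. -/
lemma exists_riesz_coeff {M : ℕ} (hHM : H ≤ fockSpace M) (h0 : fock 0 ∈ H)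
    (hdim : 1 < Module.finrank ℂ H) :
    ∃ (P : H →ₗ[ℂ] Polynomial ℂ) (m : ℕ) (v : ℕ → H), (∀ f : H, gaussPoly (P f) = f) ∧
      (∀ f, (P f).natDegree ≤ m) ∧ (∀ a f, (inner ℂ (v a) f : ℂ) = (P f).coeff a) ∧
      0 < m ∧ v m ≠ 0 ∧
      ∀ a, (inner ℂ (v a) (⟨fock 0, h0⟩ : H) : ℂ) = if a = 0 then (hermiteConst 0 : ℂ) else 0 := by
  obtain ⟨P, hP⟩ := exists_polynomial_map hHM
  have hinj : Function.Injective P := fun f g h =>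
    Subtype.ext (by rw [← hP f, ← hP g, h])
  have : CompleteSpace H := FiniteDimensional.complete ℂ H
  let e := stdOrthonormalBasis ℂ H
  have hne : (Finset.univ : Finset (Fin (Module.finrank ℂ H))).Nonempty :=
    ⟨⟨0, by omega⟩, Finset.mem_univ _⟩
  obtain ⟨j, -, hj⟩ := Finset.exists_mem_eq_sup Finset.univ hne fun j => (P (e j)).natDegree
  set m := Finset.univ.sup fun j => (P (e j)).natDegree with hmdef
  have hm (f : H) : (P f).natDegree ≤ m := by
    rw [← e.sum_repr' f, map_sum]
    refine Polynomial.natDegree_sum_le_of_forall_le _ _ fun i _ => ?_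
    rw [map_smul]
    exact (Polynomial.natDegree_smul_le _ _).trans
      (Finset.le_sup (f := fun j => (P (e j)).natDegree) (Finset.mem_univ i))
  let ℓ (a : ℕ) : H →L[ℂ] ℂ := LinearMap.toContinuousLinearMap (Polynomial.lcoeff ℂ a ∘ₗ P)
  let v (a : ℕ) : H := (InnerProductSpace.toDual ℂ H).symm (ℓ a)
  have hv (a : ℕ) (f : H) : (inner ℂ (v a) f : ℂ) = (P f).coeff a :=
    InnerProductSpace.toDual_symm_apply
  refine ⟨P, m, v, hP, hm, hv, ?_, ?_, ?_⟩
  · by_contra hm0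
    have hinj0 : Function.Injective (Polynomial.lcoeff ℂ 0 ∘ₗ P) := by
      intro f g h
      apply hinj
      rw [Polynomial.eq_C_of_natDegree_le_zero ((hm f).trans (by omega)),
        Polynomial.eq_C_of_natDegree_le_zero ((hm g).trans (by omega))]
      exact congrArg _ h
    have := LinearMap.finrank_le_finrank_of_injective hinj0
    rw [Module.finrank_self] at this
    omega
  · intro h
    have h1 := hv m (e j)
    rw [h, inner_zero_left, hj] at h1
    have h2 : P (e j) = 0 := Polynomial.leadingCoeff_eq_zero.1 h1.symm
    have h3 : e j = 0 := hinj (by rw [h2, map_zero])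
    exact e.orthonormal.ne_zero j h3
  · intro a
    have hc : P ⟨fock 0, h0⟩ = Polynomial.C (hermiteConst 0 : ℂ) :=
      gaussPoly_injective (by rw [hP, ← fock_zero_eq])
    rw [hv, hc, Polynomial.coeff_C]

/-- The quotient of the Wigner functions of operators by that of the vacuum state, together with
its behaviour at infinity: at `ζ = x + iξ` the quotient for `σ` is `⟨v, σ v⟩ |ζ| ^ (2 m)` up to
terms of lower degree, where `v ≠ 0` is orthogonal to the vacuum. -/
structure WignerQuotient (h0 : fock 0 ∈ H) where
  /-- The quotient at a point of phase space, as a functional of the operator. -/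
  toFun : ℝ × ℝ → Op H →ₗ[ℝ] ℝ
  /-- Half of the maximal degree. -/
  deg : ℕ
  /-- The vector that gives the coefficient of highest order. -/
  lead : H
  deg_pos : 0 < deg
  lead_ne : lead ≠ 0
  inner_lead : inner ℂ lead (⟨fock 0, h0⟩ : H) = 0
  wigner_rhoZero_pos : ∀ z, 0 < wigner (rhoZero h0) z
  wigner_eq : ∀ σ z, wigner σ z = wigner (rhoZero h0) z * toFun z σ
  continuous : ∀ σ, Continuous fun z => toFun z σ
  asymptotics : ∀ σ : Op H, ∃ C : ℝ, ∀ z,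
    |toFun z σ - (inner ℂ lead (σ.toCLM lead)).re * ‖phasePoint z‖ ^ (2 * deg)| ≤
      C * (1 + ‖phasePoint z‖) ^ (2 * deg - 1)

/-- In a combination of the moments of order at most `m` in each index, only the moment of order
`(m, m)` contributes to the degree `2 m`. -/
lemma sum_normMoment_asymptotics {m : ℕ} (hm : 0 < m) (S : ℕ → ℕ → ℂ) :
    ∑ a ∈ Finset.range (m + 1), ∑ b ∈ Finset.range (m + 1), S a b • normMoment a b -
      S m m • (star phasePoint ^ m * phasePoint ^ m) ∈ polyGrowth (2 * m - 1) := by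
  classical
  have hlow (a b : ℕ) (h : a + b < 2 * m) : S a b • normMoment a b ∈ polyGrowth (2 * m - 1) :=
    Submodule.smul_mem _ _ (polyGrowth_mono (by omega) (normMoment_asymptotics _ a b rfl).1)
  have hdec : ∑ a ∈ Finset.range (m + 1), ∑ b ∈ Finset.range (m + 1), S a b • normMoment a b -
      S m m • (star phasePoint ^ m * phasePoint ^ m) =
      (∑ a ∈ Finset.range m, ∑ b ∈ Finset.range (m + 1), S a b • normMoment a b) +
      (∑ b ∈ Finset.range m, S m b • normMoment m b) +
      S m m • (normMoment m m - star phasePoint ^ m * phasePoint ^ m) := by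
    rw [Finset.sum_range_succ, Finset.sum_range_succ (n := m) (f := fun b => S m b • _), smul_sub]
    abel
  rw [hdec]
  refine add_mem (add_mem (sum_mem fun a ha => sum_mem fun b hb => hlow a b ?_)
    (sum_mem fun b hb => hlow m b ?_)) (Submodule.smul_mem _ _
      (polyGrowth_mono (by omega) (normMoment_asymptotics _ m m rfl).2))
  · rw [Finset.mem_range] at ha hb
    omega
  · rw [Finset.mem_range] at hb
    omega

/-- In the combination of moments that gives `Wσ` the matrix elements of `ρ₀` vanish except for the
one at `a = b = 0`, so division by `Wρ₀` leaves a combination of the normalized moments. -/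
theorem exists_wignerQuotient {M : ℕ} (hHM : H ≤ fockSpace M) (h0 : fock 0 ∈ H)
    (hdim : 1 < Module.finrank ℂ H) : Nonempty (WignerQuotient h0) := by
  obtain ⟨P, m, v, hP, hm, hv, hm0, hvm, hvac⟩ := exists_riesz_coeff hHM h0 hdim
  set c := hermiteConst 0 with hc
  have hcpos : 0 < c := hermiteConst_zero_pos
  have hcne : (c : ℂ) ≠ 0 := by exact_mod_cast hcpos.ne'
  -- the quotient as a complex function
  let Q (σ : Op H) : ℝ × ℝ → ℂ := ∑ a ∈ Finset.range (m + 1), ∑ b ∈ Finset.range (m + 1),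
    ((c : ℂ) ^ 2)⁻¹ • (inner ℂ (v a) (σ.toCLM (v b)) : ℂ) • normMoment a b
  let κ (z : ℝ × ℝ) : ℝ := 1 / (2 * Real.pi) * (Real.exp (-z.1 ^ 2) *
    (c ^ 2 * (2 * √Real.pi * Real.exp (-z.2 ^ 2))))
  have hκ (z : ℝ × ℝ) : 0 < κ z := by
    have := Real.pi_pos
    positivity
  have hW (σ : Op H) (z : ℝ × ℝ) : wignerC σ z = κ z * Q σ z := by
    rw [wignerC_eq_sum hP hm hv]
    simp only [κ, Q, Complex.ofReal_mul (c ^ 2), ← wignerMoment_zero_zero, Finset.sum_apply,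
      Pi.smul_apply, smul_eq_mul, normMoment, Complex.ofReal_mul (1 / (2 * Real.pi)),
      Complex.ofReal_mul (Real.exp (-z.1 ^ 2)), Finset.mul_sum]
    refine Finset.sum_congr rfl fun a _ => Finset.sum_congr rfl fun b _ => ?_
    have := wignerMoment_zero_zero_ne z
    push_cast
    field_simp
  have hQ0 (z : ℝ × ℝ) : Q (rhoZero h0) z = 1 := by
    have hvac' (b : ℕ) : (inner ℂ (⟨fock 0, h0⟩ : H) (v b) : ℂ) = if b = 0 then (c : ℂ) else 0 := by
      rw [← inner_conj_symm, hvac]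
      split_ifs <;> simp
    have hent (a b : ℕ) : (inner ℂ (v a) ((rhoZero h0).toCLM (v b)) : ℂ) =
        if a = 0 ∧ b = 0 then (c : ℂ) ^ 2 else 0 := by
      have : (rhoZero h0).toCLM (v b) = (inner ℂ (⟨fock 0, h0⟩ : H) (v b) : ℂ) •
        (⟨fock 0, h0⟩ : H) := rfl
      rw [this, subspace_inner_smul_right, hvac, hvac']
      by_cases ha : a = 0 <;> by_cases hb : b = 0 <;> simp [ha, hb, sq]
    simp only [Q, Finset.sum_apply, Pi.smul_apply, smul_eq_mul, hent]
    rw [Finset.sum_eq_single_of_mem 0 (by simp) fun a _ ha => by simp [ha],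
      Finset.sum_eq_single_of_mem 0 (by simp) fun a _ ha => by simp [ha]]
    simp [normMoment_zero_zero, hcne]
  have hw (σ : Op H) (z : ℝ × ℝ) : wigner σ z = κ z * (Q σ z).re := by
    rw [wigner, hW, Complex.re_ofReal_mul]
  have hw0 (z : ℝ × ℝ) : wigner (rhoZero h0) z = κ z := by
    rw [hw, hQ0, Complex.one_re, mul_one]
  refine ⟨{ toFun := fun z =>
              { toFun := fun σ => (Q σ z).re
                map_add' := fun σ τ => ?_
                map_smul' := fun t σ => ?_ }
            deg := m
            lead := (c : ℂ)⁻¹ • v m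
            deg_pos := hm0
            lead_ne := smul_ne_zero (inv_ne_zero hcne) hvm
            inner_lead := ?_
            wigner_rhoZero_pos := fun z => by rw [hw0]; exact hκ z
            wigner_eq := fun σ z => by rw [hw0, hw]; rfl
            continuous := fun σ => ?_
            asymptotics := fun σ => ?_ }⟩
  · have (b : ℕ) : (σ + τ).toCLM (v b) = σ.toCLM (v b) + τ.toCLM (v b) := rfl
    simp only [Q, this, inner_add_right, add_smul, smul_add, Finset.sum_add_distrib,
      Pi.add_apply, Complex.add_re]
  · have (b : ℕ) : (t • σ).toCLM (v b) = (t : ℂ) • σ.toCLM (v b) := rfl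
    have hQs : Q (t • σ) = (t : ℂ) • Q σ := by
      simp only [Q, this, subspace_inner_smul_right, Finset.smul_sum]
      refine Finset.sum_congr rfl fun a _ => Finset.sum_congr rfl fun b _ => ?_
      simp only [smul_smul]
      congr 1
      ring
    rw [hQs, Pi.smul_apply, smul_eq_mul, Complex.re_ofReal_mul]
    rfl
  · rw [subspace_inner_smul_left, hvac, if_neg hm0.ne', mul_zero]
  · refine Complex.continuous_re.comp (?_ : Continuous (Q σ))
    have : Q σ ∈ polyGrowth (2 * m) := sum_mem fun a ha => sum_mem fun b hb => by
      rw [Finset.mem_range] at ha hb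
      exact Submodule.smul_mem _ _ (Submodule.smul_mem _ _
        (polyGrowth_mono (by omega) (normMoment_asymptotics _ a b rfl).1))
    exact this.1
  · have h := sum_normMoment_asymptotics hm0 fun a b =>
      ((c : ℂ) ^ 2)⁻¹ * (inner ℂ (v a) (σ.toCLM (v b)) : ℂ)
    obtain ⟨-, C, hC⟩ := h
    refine ⟨C, fun z => le_trans ?_ (hC z)⟩
    refine le_trans (le_of_eq ?_) (Complex.abs_re_le_norm _)
    simp only [LinearMap.coe_mk, AddHom.coe_mk, Pi.sub_apply, Complex.sub_re]
    congr 2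
    · simp only [Q, smul_smul]
    · have h1 : (star phasePoint ^ m * phasePoint ^ m) z =
          ((‖phasePoint z‖ ^ (2 * m) : ℝ) : ℂ) := by
        simp only [Pi.mul_apply, Pi.pow_apply, Pi.star_apply, RCLike.star_def]
        rw [← mul_pow, Complex.conj_mul', ← pow_mul]
        push_cast
        rfl
      rw [Pi.smul_apply, h1, smul_eq_mul, Complex.re_mul_ofReal, map_smul, subspace_inner_smul_left,
        subspace_inner_smul_right, RCLike.star_def, map_inv₀, Complex.conj_ofReal]
      congr 2
      rw [← mul_assoc, sq, mul_inv]
end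

/-! ### Positive operators of corank one -/

section

variable {E : Type*} [NormedAddCommGroup E] [InnerProductSpace ℂ E] {N : ℕ}

lemma isPositive_smul_add_smul {S T : E →L[ℂ] E} (hS : S.IsPositive) (hT : T.IsPositive) {a b : ℝ}
    (ha : 0 ≤ a) (hb : 0 ≤ b) : ((a : ℂ) • S + (b : ℂ) • T).IsPositive :=
  (hS.smul_of_nonneg (Complex.zero_le_real.2 ha)).add (hT.smul_of_nonneg (Complex.zero_le_real.2 hb))

lemma not_injective_of_finrank_range {T : E →L[ℂ] E} (hdim : Module.finrank ℂ E = N + 1)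
    (hr : Module.finrank ℂ (LinearMap.range T.toLinearMap) = N) : ¬ Function.Injective T := by
  intro h
  have := LinearMap.finrank_range_of_inj (f := T.toLinearMap) h
  omega

lemma rankOne_self_re_inner (u x : E) :
    (inner ℂ x (InnerProductSpace.rankOne ℂ u u x)).re = ‖(inner ℂ x u : ℂ)‖ ^ 2 := by
  rw [InnerProductSpace.rankOne_apply, inner_smul_right, ← inner_conj_symm u x, Complex.conj_mul']
  norm_cast

lemma trace_smul_add_smul (S T : E →L[ℂ] E) (a b : ℝ) :
    LinearMap.trace ℂ E ((a : ℂ) • S + (b : ℂ) • T).toLinearMap =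
      a * LinearMap.trace ℂ E S.toLinearMap + b * LinearMap.trace ℂ E T.toLinearMap := by
  rw [ContinuousLinearMap.toLinearMap_add, ContinuousLinearMap.toLinearMap_smul,
    ContinuousLinearMap.toLinearMap_smul, map_add, map_smul, map_smul, smul_eq_mul, smul_eq_mul]

/-- Symmetry is preserved by the operations of a real affine subspace. -/
lemma isSymmetric_smul_sub_add {R S T : E →L[ℂ] E} (hR : (R : E →ₗ[ℂ] E).IsSymmetric)
    (hS : (S : E →ₗ[ℂ] E).IsSymmetric) (hT : (T : E →ₗ[ℂ] E).IsSymmetric) (c : ℝ) :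
    (((c : ℂ) • (R - S) + T : E →L[ℂ] E) : E →ₗ[ℂ] E).IsSymmetric :=
  ((hR.sub hS).smul (Complex.conj_ofReal c)).add hT

lemma trace_smul_sub_add {R S T : E →L[ℂ] E} (hR : LinearMap.trace ℂ E R.toLinearMap = 1)
    (hS : LinearMap.trace ℂ E S.toLinearMap = 1) (hT : LinearMap.trace ℂ E T.toLinearMap = 1)
    (c : ℝ) : LinearMap.trace ℂ E ((c : ℂ) • (R - S) + T : E →L[ℂ] E).toLinearMap = 1 := by
  rw [ContinuousLinearMap.toLinearMap_add, ContinuousLinearMap.toLinearMap_smul,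
    ContinuousLinearMap.toLinearMap_sub, map_add, map_smul, map_sub, hR, hS, hT, sub_self,
    smul_zero, zero_add]

variable [FiniteDimensional ℂ E]

lemma apply_eq_zero_of_re_inner_eq_zero {T : E →L[ℂ] E} (hT : T.IsPositive) {x : E}
    (hx : (inner ℂ x (T x)).re = 0) : T x = 0 := by
  obtain ⟨n, w, rfl⟩ := ContinuousLinearMap.isPositive_iff_eq_sum_rankOne.1 hT
  simp only [sum_apply, InnerProductSpace.rankOne_apply, inner_sum,
    inner_smul_right, Complex.re_sum] at hx ⊢
  have h (i : Fin n) : (inner ℂ (w i) x * inner ℂ x (w i) : ℂ).re = ‖(inner ℂ (w i) x : ℂ)‖ ^ 2 := by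
    rw [← inner_conj_symm x (w i), Complex.mul_conj']
    norm_cast
  simp only [h] at hx
  have hz := (Finset.sum_eq_zero_iff_of_nonneg fun i _ => sq_nonneg _).1 hx
  refine Finset.sum_eq_zero fun i hi => ?_
  have := hz i hi
  rw [sq_eq_zero_iff, norm_eq_zero] at this
  rw [this, zero_smul]

lemma re_inner_pos_of_injective {T : E →L[ℂ] E} (hT : T.IsPositive) (hi : Function.Injective T)
    {x : E} (hx : x ≠ 0) : 0 < (inner ℂ x (T x)).re := by
  refine lt_of_le_of_ne (hT.re_inner_nonneg_right x) fun h => hx (hi ?_)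
  rw [apply_eq_zero_of_re_inner_eq_zero hT h.symm, map_zero]

/-- A convex combination of positive operators is injective if no nonzero vector is in both
kernels. -/
lemma injective_smul_add_smul {S T : E →L[ℂ] E} (hS : S.IsPositive) (hT : T.IsPositive) {a b : ℝ}
    (ha : 0 ≤ a) (hb : 0 < b) (h : ∀ x, a * (inner ℂ x (S x)).re = 0 → T x = 0 → x = 0) :
    Function.Injective ((a : ℂ) • S + (b : ℂ) • T) := by
  refine (injective_iff_map_eq_zero _).2 fun x hx => ?_
  have h1 : a * (inner ℂ x (S x)).re + b * (inner ℂ x (T x)).re = 0 := by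
    have : (inner ℂ x (((a : ℂ) • S + (b : ℂ) • T) x)).re = 0 := by rw [hx, inner_zero_right]; rfl
    rwa [add_apply, smul_apply,
      smul_apply, inner_add_right, inner_smul_right, inner_smul_right,
      Complex.add_re, Complex.re_ofReal_mul, Complex.re_ofReal_mul] at this
  have hS' : 0 ≤ (inner ℂ x (S x)).re := hS.re_inner_nonneg_right x
  have hT' : 0 ≤ (inner ℂ x (T x)).re := hT.re_inner_nonneg_right x
  have h2 := mul_nonneg ha hS'
  have h3 := mul_nonneg hb.le hT'
  refine h x (by linarith) (apply_eq_zero_of_re_inner_eq_zero hT ?_)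
  exact (mul_eq_zero.1 (by linarith : b * (inner ℂ x (T x)).re = 0)).resolve_left hb.ne'

/-- The injective positive operators are in the interior of the positive ones, relative to the
symmetric operators. -/
lemma exists_isPositive_of_norm_sub_lt {T : E →L[ℂ] E} (hT : T.IsPositive)
    (hi : Function.Injective T) : ∃ ε > 0, ∀ S : E →L[ℂ] E,
      (S : E →ₗ[ℂ] E).IsSymmetric → ‖S - T‖ < ε → S.IsPositive := by
  have hproper : ProperSpace E := FiniteDimensional.proper ℂ E
  obtain ⟨c, hc, hcT⟩ : ∃ c > 0, ∀ x ∈ Metric.sphere (0 : E) 1, c ≤ (inner ℂ x (T x)).re := by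
    rcases (Metric.sphere (0 : E) 1).eq_empty_or_nonempty with h | h
    · exact ⟨1, one_pos, by simp [h]⟩
    · obtain ⟨x₀, hx₀, hmin⟩ := (isCompact_sphere (0 : E) 1).exists_isMinOn h
        (f := fun x => (inner ℂ x (T x)).re) (by fun_prop)
      refine ⟨_, re_inner_pos_of_injective hT hi (x := x₀) ?_, fun x hx => hmin hx⟩
      rintro rfl
      simp at hx₀
  have hcT' (x : E) : c * ‖x‖ ^ 2 ≤ (inner ℂ x (T x)).re := by
    rcases eq_or_ne x 0 with rfl | hx
    · simp
    have hn : 0 < ‖x‖ := norm_pos_iff.2 hx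
    have h1 := hcT (((‖x‖⁻¹ : ℝ) : ℂ) • x) (by
      rw [mem_sphere_zero_iff_norm, norm_smul, Complex.norm_real, norm_inv, norm_norm,
        inv_mul_cancel₀ hn.ne'])
    rw [map_smul, inner_smul_left, inner_smul_right, Complex.conj_ofReal, Complex.re_ofReal_mul,
      Complex.re_ofReal_mul] at h1
    calc c * ‖x‖ ^ 2 ≤ (‖x‖⁻¹ * (‖x‖⁻¹ * (inner ℂ x (T x)).re)) * ‖x‖ ^ 2 := by gcongr
      _ = _ := by field_simp
  refine ⟨c, hc, fun S hS hST => ⟨hS, fun x => ?_⟩⟩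
  rw [ContinuousLinearMap.reApplyInnerSelf_apply, inner_re_symm]
  change 0 ≤ (inner ℂ x (S x)).re
  have h1 : (inner ℂ x (S x)).re = (inner ℂ x (T x)).re + (inner ℂ x ((S - T) x)).re := by
    rw [← Complex.add_re, ← inner_add_right, sub_apply, add_sub_cancel]
  have h2 : |(inner ℂ x ((S - T) x)).re| ≤ ‖S - T‖ * ‖x‖ ^ 2 := by
    refine (Complex.abs_re_le_norm _).trans ((norm_inner_le_norm _ _).trans ?_)
    calc ‖x‖ * ‖(S - T) x‖ ≤ ‖x‖ * (‖S - T‖ * ‖x‖) := by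
          gcongr
          exact (S - T).le_opNorm x
      _ = _ := by ring
  have h3 := mul_le_mul_of_nonneg_right hST.le (sq_nonneg ‖x‖)
  linarith [hcT' x, (abs_le.1 h2).1]

/-- A vector outside the range of a positive operator of corank one is not orthogonal to the
kernel, since the range is the orthogonal complement of the kernel. -/
lemma inner_ne_zero_of_notMem_range {T : E →L[ℂ] E} (hT : T.IsPositive)
    (hdim : Module.finrank ℂ E = N + 1) (hr : Module.finrank ℂ (LinearMap.range T.toLinearMap) = N)
    {u : E} (hu : u ∉ LinearMap.range T.toLinearMap) {x : E} (hx : x ≠ 0) (hTx : T x = 0) :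
    inner ℂ x u ≠ 0 := by
  intro hxu
  have hle : LinearMap.range T.toLinearMap ≤ (ℂ ∙ x)ᗮ := by
    rintro _ ⟨y, rfl⟩
    rw [Submodule.mem_orthogonal_singleton_iff_inner_right]
    have := hT.isSymmetric x y
    simp only [ContinuousLinearMap.coe_coe, hTx, inner_zero_left] at this
    exact this.symm
  have hfin : Module.finrank ℂ (ℂ ∙ x)ᗮ = N :=
    Submodule.finrank_orthogonal_span_singleton (𝕜 := ℂ) (_i := ⟨hdim⟩) hx
  have heq := Submodule.eq_of_le_of_finrank_eq hle (hr.trans hfin.symm)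
  exact hu (heq ▸ (Submodule.mem_orthogonal_singleton_iff_inner_right.2 hxu))

lemma injective_smul_rankOne_add_smul {T : E →L[ℂ] E} (hT : T.IsPositive)
    (hdim : Module.finrank ℂ E = N + 1) (hr : Module.finrank ℂ (LinearMap.range T.toLinearMap) = N)
    {u : E} (hu : u ∉ LinearMap.range T.toLinearMap) {a b : ℝ} (ha : 0 < a) (hb : 0 < b) :
    Function.Injective ((a : ℂ) • InnerProductSpace.rankOne ℂ u u + (b : ℂ) • T) := by
  refine injective_smul_add_smul (InnerProductSpace.isPositive_rankOne_self u) hT ha.le hb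
    fun x hx hTx => ?_
  by_contra hx0
  refine inner_ne_zero_of_notMem_range hT hdim hr hu hx0 hTx ?_
  rw [rankOne_self_re_inner] at hx
  simpa [ha.ne'] using hx

/-- Subtraction of the largest possible multiple of a rank one operator from an injective positive
operator `T`. The multiple is `1 / ⟨u, T⁻¹ u⟩`, and the kernel of the difference is spanned by
`T⁻¹ u`. -/
lemma exists_sub_smul_rankOne {T : E →L[ℂ] E} (hT : T.IsPositive) (hi : Function.Injective T)
    (hdim : Module.finrank ℂ E = N + 1) {u : E} (hu : u ≠ 0) :
    ∃ (l : ℝ) (A : E →L[ℂ] E), 0 < l ∧ A.IsPositive ∧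
      Module.finrank ℂ (LinearMap.range A.toLinearMap) = N ∧ u ∉ LinearMap.range A.toLinearMap ∧
      T = (l : ℂ) • InnerProductSpace.rankOne ℂ u u + A := by
  obtain ⟨w, hw⟩ := (LinearMap.injective_iff_surjective (f := T.toLinearMap)).1 hi u
  have hw : T w = u := hw
  have hw0 : w ≠ 0 := by
    rintro rfl
    exact hu (by rw [← hw, map_zero])
  have hpos := re_inner_pos_of_injective hT hi hw0
  rw [hw] at hpos
  have hreal : (inner ℂ w u : ℂ) = (((inner ℂ w u : ℂ).re : ℝ) : ℂ) := by
    have := hT.inner_nonneg_right w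
    rw [hw] at this
    exact (Complex.eq_re_of_ofReal_le (r := 0) (by simpa using this))
  set s : ℝ := (inner ℂ w u : ℂ).re with hs
  have hreal' : (inner ℂ u w : ℂ) = (s : ℂ) := by
    rw [← inner_conj_symm, hreal, Complex.conj_ofReal]
  have hsne : (s : ℂ) ≠ 0 := by exact_mod_cast hpos.ne'
  set A : E →L[ℂ] E := T - ((s⁻¹ : ℝ) : ℂ) • InnerProductSpace.rankOne ℂ u u with hA
  have hAx (x : E) : A x = T x - ((s : ℂ)⁻¹ * inner ℂ u x) • u := by
    rw [hA, sub_apply, smul_apply,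
      InnerProductSpace.rankOne_apply, smul_smul, Complex.ofReal_inv]
  have hAw : A w = 0 := by
    rw [hAx, hw, hreal', inv_mul_cancel₀ hsne, one_smul, sub_self]
  have hsymm : (A : E →ₗ[ℂ] E).IsSymmetric := by
    intro x y
    have := hT.isSymmetric x y
    simp only [ContinuousLinearMap.coe_coe] at this ⊢
    rw [hAx, hAx, inner_sub_left, inner_sub_right, this, inner_smul_left, inner_smul_right, map_mul,
      map_inv₀, Complex.conj_ofReal, inner_conj_symm]
    ring
  have hker (x : E) (hx : A x = 0) : x ∈ ℂ ∙ w := by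
    rw [hAx, sub_eq_zero, ← hw, ← map_smul] at hx
    rw [hi hx]
    exact Submodule.smul_mem _ _ (Submodule.mem_span_singleton_self w)
  refine ⟨s⁻¹, A, inv_pos.2 hpos, ⟨hsymm, fun x => ?_⟩, ?_, ?_, by rw [hA]; abel⟩
  · -- shift `x` by a multiple of `w`, which is in the kernel, to make it orthogonal to `u`
    set y := x - ((s : ℂ)⁻¹ * inner ℂ u x) • w with hy
    have huy : (inner ℂ u y : ℂ) = 0 := by
      rw [hy, inner_sub_right, inner_smul_right, hreal']
      field_simp
      ring
    have hAy : A y = A x := by rw [hy, map_sub, map_smul, hAw, smul_zero, sub_zero]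
    have hAy' : A y = T y := by rw [hAx, huy, mul_zero, zero_smul, sub_zero]
    have hxy : inner ℂ (A x) x = (inner ℂ (T y) y : ℂ) := by
      have h1 : inner ℂ (A y) w = (0 : ℂ) := by
        have := hsymm y w
        simp only [ContinuousLinearMap.coe_coe] at this
        rw [this, hAw, inner_zero_right]
      have h2 : inner ℂ (A y) y = (inner ℂ (A y) x : ℂ) := by
        conv_lhs => rw [hy, inner_sub_right, inner_smul_right, ← hy, h1, mul_zero, sub_zero]
      rw [← hAy, ← h2, hAy']
    change 0 ≤ RCLike.re (inner ℂ (A x) x)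
    rw [hxy]
    exact hT.re_inner_nonneg_left y
  · have hk : LinearMap.ker A.toLinearMap = ℂ ∙ w := by
      refine le_antisymm (fun x hx => hker x hx) ?_
      rw [Submodule.span_singleton_le_iff_mem]
      exact hAw
    have := LinearMap.finrank_range_add_finrank_ker A.toLinearMap
    rw [hk, finrank_span_singleton hw0] at this
    omega
  · rintro ⟨x, hx⟩
    have h := hsymm w x
    rw [hx] at h
    simp only [ContinuousLinearMap.coe_coe, hAw, inner_zero_left] at h
    rw [hreal] at h
    exact hsne h.symm

lemma eq_zero_of_trace_re_eq_zero {T : E →L[ℂ] E} (hT : T.IsPositive)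
    (h : (LinearMap.trace ℂ E T.toLinearMap).re = 0) : T = 0 := by
  let e := stdOrthonormalBasis ℂ E
  rw [LinearMap.trace_eq_sum_inner _ e, Complex.re_sum] at h
  have hz := (Finset.sum_eq_zero_iff_of_nonneg
    fun i _ => hT.re_inner_nonneg_right (e i)).1 h
  refine ContinuousLinearMap.coe_injective (e.toBasis.ext fun i => ?_)
  simpa using apply_eq_zero_of_re_inner_eq_zero hT (hz i (Finset.mem_univ i))

lemma trace_re_nonneg {T : E →L[ℂ] E} (hT : T.IsPositive) :
    0 ≤ (LinearMap.trace ℂ E T.toLinearMap).re := by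
  rw [LinearMap.trace_eq_sum_inner _ (stdOrthonormalBasis ℂ E), Complex.re_sum]
  exact Finset.sum_nonneg fun i _ => hT.re_inner_nonneg_right _

lemma traceNorm_smul {t : ℝ} (ht : 0 ≤ t) (A : E →L[ℂ] E) :
    traceNorm ((t : ℂ) • A) = t * traceNorm A := by
  have : CompleteSpace E := FiniteDimensional.complete ℂ E
  have h : CFC.abs ((t : ℂ) • A) = (t : ℂ) • CFC.abs A := by
    rw [CFC.abs_smul, Complex.norm_real, Real.norm_of_nonneg ht]
    rfl
  unfold traceNorm
  rw [h, ContinuousLinearMap.toLinearMap_smul, map_smul, smul_eq_mul, Complex.re_ofReal_mul]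

lemma traceNorm_ne_zero {A : E →L[ℂ] E} (hA : A ≠ 0) : traceNorm A ≠ 0 := by
  have : CompleteSpace E := FiniteDimensional.complete ℂ E
  intro h
  have h1 : (CFC.abs A).IsPositive :=
    (ContinuousLinearMap.nonneg_iff_isPositive _).1 (CFC.abs_nonneg A)
  exact hA (CFC.abs_eq_zero_iff.1 (eq_zero_of_trace_re_eq_zero h1 h))

lemma trace_rankOne_self {u : E} (hu : ‖u‖ = 1) :
    LinearMap.trace ℂ E (InnerProductSpace.rankOne ℂ u u).toLinearMap = 1 := by
  rw [InnerProductSpace.trace_rankOne, inner_self_eq_norm_sq_to_K, hu]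
  simp

lemma isClosed_isPositive_trace_eq_one :
    IsClosed {T : E →L[ℂ] E | T.IsPositive ∧ LinearMap.trace ℂ E T.toLinearMap = 1} := by
  have h1 : IsClosed {T : E →L[ℂ] E | T.IsPositive} := by
    simp only [ContinuousLinearMap.isPositive_iff_complex, Set.ofPred_forall, Set.ofPred_and]
    refine isClosed_iInter fun x => (isClosed_eq ?_ ?_).inter (isClosed_le ?_ ?_) <;> fun_prop
  have h2 : Continuous fun T : E →L[ℂ] E => LinearMap.trace ℂ E T.toLinearMap :=
    (LinearMap.trace ℂ E ∘ₗ ContinuousLinearMap.coeLM ℂ).continuous_of_finiteDimensional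
  exact h1.inter (isClosed_eq h2 continuous_const)

/-- A positive operator of corank one is positive definite on the orthogonal complement of a vector
outside its range. -/
lemma re_inner_pos_of_notMem_range {T : E →L[ℂ] E} (hT : T.IsPositive)
    (hdim : Module.finrank ℂ E = N + 1) (hr : Module.finrank ℂ (LinearMap.range T.toLinearMap) = N)
    {u : E} (hu : u ∉ LinearMap.range T.toLinearMap) {x : E} (hx : x ≠ 0)
    (hxu : inner ℂ x u = (0 : ℂ)) : 0 < (inner ℂ x (T x)).re :=
  lt_of_le_of_ne (hT.re_inner_nonneg_right x) fun h =>
    inner_ne_zero_of_notMem_range hT hdim hr hu hx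
      (apply_eq_zero_of_re_inner_eq_zero hT h.symm) hxu

end

/-! ### The relative interior of the Wigner-positive states -/

section

variable {H : Submodule ℂ L2R}

lemma convex_densityMatrices : Convex ℝ (densityMatrices H) := by
  intro σ hσ τ hτ a b ha hb hab
  refine ⟨isPositive_smul_add_smul hσ.1 hτ.1 ha hb, ?_⟩
  refine (trace_smul_add_smul σ.toCLM τ.toCLM a b).trans ?_
  have h1 : LinearMap.trace ℂ H σ.toCLM.toLinearMap = 1 := hσ.2
  have h2 : LinearMap.trace ℂ H τ.toCLM.toLinearMap = 1 := hτ.2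
  rw [h1, h2, mul_one, mul_one]
  exact_mod_cast hab

/-- The symmetric operators of trace one. -/
def symmetricTraceOne (H : Submodule ℂ L2R) : AffineSubspace ℝ (Op H) where
  carrier := {σ | (σ.toCLM : H →ₗ[ℂ] H).IsSymmetric ∧
    LinearMap.trace ℂ H σ.toCLM.toLinearMap = 1}
  smul_vsub_vadd_mem' c _ _ _ h1 h2 h3 :=
    ⟨isSymmetric_smul_sub_add h1.1 h2.1 h3.1 c, trace_smul_sub_add h1.2 h2.2 h3.2 c⟩

variable [FiniteDimensional ℂ H] {h0 : fock 0 ∈ H}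

instance : FiniteDimensional ℝ (Op H) :=
  have : FiniteDimensional ℂ (Op H) := inferInstanceAs (FiniteDimensional ℂ (H →L[ℂ] H))
  FiniteDimensional.complexToReal (Op H)

lemma isClosed_densityMatrices : IsClosed (densityMatrices H) :=
  isClosed_isPositive_trace_eq_one (E := H)

lemma rhoZero_mem_densityMatrices : rhoZero h0 ∈ densityMatrices H :=
  ⟨InnerProductSpace.isPositive_rankOne_self _, trace_rankOne_self norm_fock_zero⟩

namespace WignerQuotient

variable (D : WignerQuotient h0)

lemma wigner_div (σ : Op H) (z : ℝ × ℝ) :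
    wigner σ z / wigner (rhoZero h0) z = D.toFun z σ := by
  rw [D.wigner_eq, mul_div_cancel_left₀ _ (D.wigner_rhoZero_pos z).ne']

lemma toFun_rhoZero (z : ℝ × ℝ) : D.toFun z (rhoZero h0) = 1 := by
  rw [← D.wigner_div, div_self (D.wigner_rhoZero_pos z).ne']

lemma toFun_combination (z : ℝ × ℝ) (a b : ℝ) (σ τ : Op H) :
    D.toFun z (a • σ + b • τ) = a * D.toFun z σ + b * D.toFun z τ := by
  rw [map_add, map_smul, map_smul, smul_eq_mul, smul_eq_mul]

lemma mem_wignerPositive_iff (D : WignerQuotient h0) {ρ : Op H} :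
    ρ ∈ wignerPositive H ↔ ρ ∈ densityMatrices H ∧ ∀ z, 0 ≤ D.toFun z ρ := by
  refine and_congr_right fun _ => forall_congr' fun z => ?_
  rw [D.wigner_eq, mul_nonneg_iff_of_pos_left (D.wigner_rhoZero_pos z)]

lemma isClosed_wignerPositive (D : WignerQuotient h0) : IsClosed (wignerPositive H) := by
  have : wignerPositive H = densityMatrices H ∩ ⋂ z, {ρ | 0 ≤ D.toFun z ρ} := by
    ext ρ
    simp [D.mem_wignerPositive_iff]
  rw [this]
  exact isClosed_densityMatrices.inter (isClosed_iInter fun z =>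
    isClosed_le continuous_const (D.toFun z).continuous_of_finiteDimensional)

/-- The coefficient of highest order in the Wigner quotient. -/
def leadCoeff (σ : Op H) : ℝ := (inner ℂ D.lead (σ.toCLM D.lead)).re

/-- A positive coefficient of highest order makes the Wigner quotient grow at the maximal rate. -/
lemma exists_le_of_leadCoeff_pos {σ : Op H} (hσ : 0 < D.leadCoeff σ) :
    ∃ c > 0, ∃ R, ∀ z, R ≤ ‖phasePoint z‖ →
      c * (1 + ‖phasePoint z‖) ^ (2 * D.deg) ≤ D.toFun z σ := by
  obtain ⟨C, hC⟩ := D.asymptotics σ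
  set c := D.leadCoeff σ * (1 / 2) ^ (2 * D.deg) / 2 with hc
  have hc0 : 0 < c := by positivity
  refine ⟨c, hc0, max 1 (C / c), fun z hz => ?_⟩
  have h1 : 1 ≤ ‖phasePoint z‖ := (le_max_left _ _).trans hz
  have h2 : C ≤ c * (1 + ‖phasePoint z‖) := by
    have := (le_max_right _ _).trans hz
    rw [div_le_iff₀ hc0] at this
    linarith
  set n := ‖phasePoint z‖ with hn
  have h3 : C * (1 + n) ^ (2 * D.deg - 1) ≤ c * (1 + n) ^ (2 * D.deg) := by
    calc C * (1 + n) ^ (2 * D.deg - 1) ≤ c * (1 + n) * (1 + n) ^ (2 * D.deg - 1) := by gcongr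
      _ = c * (1 + n) ^ (2 * D.deg - 1 + 1) := by ring
      _ = _ := by rw [Nat.sub_add_cancel (by have := D.deg_pos; omega)]
  have h4 : 2 * c * (1 + n) ^ (2 * D.deg) ≤ D.leadCoeff σ * n ^ (2 * D.deg) := by
    calc 2 * c * (1 + n) ^ (2 * D.deg) = D.leadCoeff σ * ((1 + n) / 2) ^ (2 * D.deg) := by
          rw [hc, div_pow, div_pow, one_pow]
          ring
      _ ≤ _ := by
          gcongr
          linarith
  have h5 := (abs_le.1 (hC z)).1
  change _ ≤ D.toFun z σ - D.leadCoeff σ * n ^ (2 * D.deg) at h5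
  linarith

lemma exists_abs_le (σ : Op H) :
    ∃ C, ∀ z, |D.toFun z σ| ≤ C * (1 + ‖phasePoint z‖) ^ (2 * D.deg) := by
  obtain ⟨C, hC⟩ := D.asymptotics σ
  refine ⟨|D.leadCoeff σ| + |C|, fun z => ?_⟩
  have h := hC z
  change |D.toFun z σ - D.leadCoeff σ * ‖phasePoint z‖ ^ (2 * D.deg)| ≤ _ at h
  have h1 := abs_sub_abs_le_abs_sub (D.toFun z σ) (D.leadCoeff σ * ‖phasePoint z‖ ^ (2 * D.deg))
  rw [abs_mul, abs_of_nonneg (a := ‖phasePoint z‖ ^ (2 * D.deg)) (by positivity)] at h1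
  have h2 : C * (1 + ‖phasePoint z‖) ^ (2 * D.deg - 1) ≤
      |C| * (1 + ‖phasePoint z‖) ^ (2 * D.deg) := by
    gcongr
    · exact le_abs_self C
    · linarith [norm_nonneg (phasePoint z)]
    · omega
  have h3 : |D.leadCoeff σ| * ‖phasePoint z‖ ^ (2 * D.deg) ≤
      |D.leadCoeff σ| * (1 + ‖phasePoint z‖) ^ (2 * D.deg) := by
    gcongr
    linarith
  linarith

/-- The bound on the growth of the Wigner quotient is uniform in the operator. -/
lemma exists_abs_le_norm :
    ∃ C > 0, ∀ σ z, |D.toFun z σ| ≤ C * ‖σ‖ * (1 + ‖phasePoint z‖) ^ (2 * D.deg) := by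
  have hcomplete : CompleteSpace (Op H) := FiniteDimensional.complete ℝ (Op H)
  let g (z : ℝ × ℝ) : Op H →L[ℝ] ℝ := ((1 + ‖phasePoint z‖) ^ (2 * D.deg))⁻¹ •
    LinearMap.toContinuousLinearMap (D.toFun z)
  have hg (z : ℝ × ℝ) (σ : Op H) :
      ‖g z σ‖ = |D.toFun z σ| / (1 + ‖phasePoint z‖) ^ (2 * D.deg) := by
    change ‖((1 + ‖phasePoint z‖) ^ (2 * D.deg))⁻¹ * D.toFun z σ‖ = _
    rw [norm_mul, norm_inv, Real.norm_of_nonneg (by positivity), Real.norm_eq_abs, mul_comm,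
      div_eq_mul_inv]
  obtain ⟨C, hC⟩ := banach_steinhaus (g := g) fun σ => by
    obtain ⟨C, hC⟩ := D.exists_abs_le σ
    refine ⟨C, fun z => ?_⟩
    rw [hg, div_le_iff₀ (by positivity)]
    exact hC z
  refine ⟨max C 1, by positivity, fun σ z => ?_⟩
  have h := (g z).le_of_opNorm_le ((hC z).trans (le_max_left C 1)) σ
  rwa [hg, div_le_iff₀ (by positivity)] at h

/-- The quotient is nonnegative outside a compact set, so `0` and its values have a minimum. -/
lemma exists_isLeast {σ : Op H} (hσ : 0 < D.leadCoeff σ) :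
    ∃ k, IsLeast (wignerRatios h0 σ) k := by
  obtain ⟨c, hc, R, hR⟩ := D.exists_le_of_leadCoeff_pos hσ
  obtain ⟨z₀, -, hz₀⟩ := (isCompact_closedBall (0 : ℝ × ℝ) |R|).exists_isMinOn
    (Metric.nonempty_closedBall.2 (abs_nonneg R)) (D.continuous σ).continuousOn
  have hrat : wignerRatios h0 σ = insert 0 (Set.range fun z => D.toFun z σ) := by
    simp only [wignerRatios, D.wigner_div]
  rw [hrat]
  refine ⟨min 0 (D.toFun z₀ σ), ?_, ?_⟩
  · rcases min_choice 0 (D.toFun z₀ σ) with h | h <;> rw [h]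
    · exact Set.mem_insert _ _
    · exact Set.mem_insert_of_mem _ ⟨z₀, rfl⟩
  · rintro _ (rfl | ⟨z, rfl⟩)
    · exact min_le_left _ _
    by_cases hz : z ∈ Metric.closedBall (0 : ℝ × ℝ) |R|
    · exact (min_le_right _ _).trans (hz₀ hz)
    · refine (min_le_left _ _).trans (le_trans (by positivity) (hR z ?_))
      rw [mem_closedBall_zero_iff, not_le] at hz
      have hre : (phasePoint z).re = z.1 := by simp [phasePoint]
      have him : (phasePoint z).im = z.2 := by simp [phasePoint]
      refine (le_abs_self R).trans (hz.le.trans (max_le ?_ ?_))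
      · rw [Real.norm_eq_abs, ← hre]
        exact Complex.abs_re_le_norm _
      · rw [Real.norm_eq_abs, ← him]
        exact Complex.abs_im_le_norm _

lemma leadCoeff_pos_of_injective {σ : Op H} (hσ : σ ∈ densityMatrices H)
    (hi : Function.Injective σ.toCLM) : 0 < D.leadCoeff σ :=
  re_inner_pos_of_injective hσ.1 hi D.lead_ne

lemma leadCoeff_pos_of_mem_generatorY {N : ℕ} (hdim : Module.finrank ℂ H = N + 1) {σ : Op H}
    (hσ : σ ∈ generatorY h0 N) : 0 < D.leadCoeff σ :=
  re_inner_pos_of_notMem_range hσ.1.1 hdim hσ.2.1 hσ.2.2 D.lead_ne D.inner_lead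

/-- The invertible density matrices whose Wigner quotient is bounded away from zero. This is the
relative interior of the set of Wigner-positive states. -/
def core : Set (Op H) :=
  {σ | σ ∈ densityMatrices H ∧ Function.Injective σ.toCLM ∧ ∃ δ > 0, ∀ z, δ ≤ D.toFun z σ}

lemma core_subset : D.core ⊆ wignerPositive H := fun _ ⟨h1, _, _, hδ, h⟩ =>
  D.mem_wignerPositive_iff.2 ⟨h1, fun z => hδ.le.trans (h z)⟩

lemma combination_mem_core {σ τ : Op H} (hσ : σ ∈ wignerPositive H) (hτ : τ ∈ D.core) {a b : ℝ}
    (ha : 0 ≤ a) (hb : 0 < b) (hab : a + b = 1) : a • σ + b • τ ∈ D.core := by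
  obtain ⟨hτ1, hτ2, δ, hδ, hτ3⟩ := hτ
  rw [D.mem_wignerPositive_iff] at hσ
  refine ⟨convex_densityMatrices hσ.1 hτ1 ha hb.le hab,
    injective_smul_add_smul hσ.1.1 hτ1.1 ha hb fun x _ hx => hτ2 (by rw [hx, map_zero]),
    b * δ, mul_pos hb hδ, fun z => ?_⟩
  rw [toFun_combination]
  have h1 := mul_nonneg ha (hσ.2 z)
  have h2 := mul_le_mul_of_nonneg_left (hτ3 z) hb.le
  linarith

/-- A state near the vacuum on the segment from the vacuum to the maximally mixed state. -/
lemma core_nonempty : D.core.Nonempty := by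
  have hpos : 0 < Module.finrank ℂ H := Module.finrank_pos_iff_exists_ne_zero.2 ⟨_, D.lead_ne⟩
  have hne : (Module.finrank ℂ H : ℂ) ≠ 0 := by exact_mod_cast hpos.ne'
  let mix : Op H := ((Module.finrank ℂ H : ℂ)⁻¹ • ContinuousLinearMap.id ℂ H : H →L[ℂ] H)
  have hinj : Function.Injective mix.toCLM := smul_right_injective H (inv_ne_zero hne)
  have hmix : mix ∈ densityMatrices H := by
    refine ⟨ContinuousLinearMap.isPositive_id.smul_of_nonneg ?_, ?_⟩
    · have : (Module.finrank ℂ H : ℂ)⁻¹ = (((Module.finrank ℂ H : ℝ)⁻¹ : ℝ) : ℂ) := by push_cast; rfl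
      rw [this, Complex.zero_le_real]
      positivity
    · have : mix.toCLM.toLinearMap = (Module.finrank ℂ H : ℂ)⁻¹ • LinearMap.id := rfl
      rw [this, map_smul, LinearMap.trace_id, smul_eq_mul, inv_mul_cancel₀ hne]
  obtain ⟨k, hk⟩ := D.exists_isLeast (D.leadCoeff_pos_of_injective hmix hinj)
  have hk0 : k ≤ 0 := hk.2 (Set.mem_insert _ _)
  have hkz (z : ℝ × ℝ) : k ≤ D.toFun z mix := by
    rw [← D.wigner_div]
    exact hk.2 (Set.mem_insert_of_mem _ ⟨z, rfl⟩)
  -- the weight for which the lower bound of the quotient is `1 / 2`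
  set s := 1 / (2 * (1 - k)) with hs
  have hs0 : 0 < s := by
    have : 0 < 1 - k := by linarith
    positivity
  have hsk : s * (1 - k) = 1 / 2 := by
    rw [hs]
    field_simp [show (1 - k) ≠ 0 by linarith]
  have hs1 : s ≤ 1 := by nlinarith
  refine ⟨(1 - s) • rhoZero h0 + s • mix,
    convex_densityMatrices rhoZero_mem_densityMatrices hmix (by linarith) hs0.le (by ring),
    injective_smul_add_smul (a := 1 - s) rhoZero_mem_densityMatrices.1 hmix.1 (by linarith) hs0
      fun x _ hx => hinj (by rw [hx, map_zero]), 1 / 2, by norm_num, fun z => ?_⟩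
  rw [toFun_combination, toFun_rhoZero]
  have := mul_le_mul_of_nonneg_left (hkz z) hs0.le
  linarith

/-- An element of the core has a Wigner quotient of maximal growth, so all symmetric operators of
trace one in a neighbourhood are Wigner-positive states. -/
lemma exists_ball_of_mem_core {ρ : Op H} (hρ : ρ ∈ D.core) :
    ∃ ε > 0, ∀ σ ∈ symmetricTraceOne H, ‖σ - ρ‖ < ε → σ ∈ wignerPositive H := by
  obtain ⟨hρ1, hρ2, δ, hδ, hρ3⟩ := hρ
  obtain ⟨ε₁, hε₁, hpos⟩ := exists_isPositive_of_norm_sub_lt hρ1.1 hρ2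
  obtain ⟨c, hc, R, hR⟩ := D.exists_le_of_leadCoeff_pos (D.leadCoeff_pos_of_injective hρ1 hρ2)
  obtain ⟨C, hC, hbound⟩ := D.exists_abs_le_norm
  obtain ⟨c', hc', hlow⟩ : ∃ c' > 0, ∀ z,
      c' * (1 + ‖phasePoint z‖) ^ (2 * D.deg) ≤ D.toFun z ρ := by
    have hR0 : 0 < (1 + |R|) ^ (2 * D.deg) := by positivity
    refine ⟨min c (δ / (1 + |R|) ^ (2 * D.deg)), lt_min hc (div_pos hδ hR0), fun z => ?_⟩
    rcases le_total R ‖phasePoint z‖ with h | h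
    · refine le_trans ?_ (hR z h)
      gcongr
      exact min_le_left _ _
    · refine le_trans ?_ (hρ3 z)
      calc _ ≤ δ / (1 + |R|) ^ (2 * D.deg) * (1 + |R|) ^ (2 * D.deg) := by
            gcongr
            · exact min_le_right _ _
            · exact h.trans (le_abs_self R)
        _ = δ := div_mul_cancel₀ _ hR0.ne'
  refine ⟨min ε₁ (c' / C), lt_min hε₁ (div_pos hc' hC), fun σ hσ hσρ => ?_⟩
  refine D.mem_wignerPositive_iff.2
    ⟨⟨hpos σ.toCLM hσ.1 (hσρ.trans_le (min_le_left _ _)), hσ.2⟩, fun z => ?_⟩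
  have h1 := (abs_le.1 (hbound (σ - ρ) z)).1
  have h2 : C * ‖σ - ρ‖ * (1 + ‖phasePoint z‖) ^ (2 * D.deg) ≤
      c' * (1 + ‖phasePoint z‖) ^ (2 * D.deg) := by
    gcongr
    have := hσρ.le.trans (min_le_right _ _)
    rwa [le_div_iff₀ hC, mul_comm] at this
  rw [map_sub] at h1
  linarith [hlow z]

theorem intrinsicInterior_eq : intrinsicInterior ℝ (wignerPositive H) = D.core := by
  refine Set.Subset.antisymm (fun ρ hρ => ?_) fun ρ hρ => ?_
  · -- the line from a point of the core through `ρ` can be prolonged within the set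
    obtain ⟨κ, hκ⟩ := D.core_nonempty
    obtain ⟨y, hy, rfl⟩ := mem_intrinsicInterior.1 hρ
    have hκs : κ ∈ affineSpan ℝ (wignerPositive H) := subset_affineSpan ℝ _ (D.core_subset hκ)
    let f (t : ℝ) : affineSpan ℝ (wignerPositive H) :=
      ⟨AffineMap.lineMap κ (y : Op H) t, AffineMap.lineMap_mem t hκs y.2⟩
    have hf : Continuous f := AffineMap.lineMap_continuous.subtype_mk _
    have hf1 : f 1 = y := Subtype.ext (AffineMap.lineMap_apply_one _ _)
    have hnhds : ∀ᶠ t in nhds (1 : ℝ), (f t : Op H) ∈ wignerPositive H := by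
      refine hf.continuousAt.preimage_mem_nhds (t := Subtype.val ⁻¹' wignerPositive H) ?_
      rw [hf1]
      exact mem_interior_iff_mem_nhds.1 hy
    obtain ⟨t, ht, ht1⟩ := ((hnhds.filter_mono nhdsWithin_le_nhds).and
      (self_mem_nhdsWithin (s := Set.Ioi (1 : ℝ)))).exists
    have ht1 : 1 < t := ht1
    have hcomb : (y : Op H) = t⁻¹ • (f t : Op H) + (1 - t⁻¹) • κ := by
      have : (f t : Op H) = (1 - t) • κ + t • (y : Op H) := AffineMap.lineMap_apply_module _ _ _
      rw [this]
      match_scalars <;> field_simp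
      ring
    rw [hcomb]
    exact D.combination_mem_core ht hκ (by positivity) (by linarith [inv_lt_one_of_one_lt₀ ht1])
      (by ring)
  · obtain ⟨ε, hε, h⟩ := D.exists_ball_of_mem_core hρ
    have hspan : affineSpan ℝ (wignerPositive H) ≤ symmetricTraceOne H :=
      affineSpan_le.2 fun σ hσ => ⟨hσ.1.1.isSymmetric, hσ.1.2⟩
    refine mem_intrinsicInterior.2
      ⟨⟨ρ, subset_affineSpan ℝ _ (D.core_subset hρ)⟩, ?_, rfl⟩
    rw [mem_interior_iff_mem_nhds]
    filter_upwards [Metric.ball_mem_nhds _ hε] with σ hσ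
    refine h σ (hspan σ.2) ?_
    rwa [Metric.mem_ball, Subtype.dist_eq, dist_eq_norm] at hσ

theorem intrinsicFrontier_eq :
    intrinsicFrontier ℝ (wignerPositive H) = wignerPositive H \ D.core := by
  rw [← closure_sdiff_intrinsicInterior, D.isClosed_wignerPositive.closure_eq,
    D.intrinsicInterior_eq]

end WignerQuotient
end

/-! ### Segments from the vacuum state -/

lemma mem_openSeg_iff {V : Type*} [AddCommGroup V] [Module ℝ V] {u v x : V} (huv : u ≠ v) :
    x ∈ openSeg u v ↔ ∃ s : ℝ, 0 < s ∧ s < 1 ∧ x = (1 - s) • u + s • v := by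
  unfold openSeg
  rw [segment_eq_image]
  constructor
  · rintro ⟨⟨s, ⟨hs0, hs1⟩, rfl⟩, hne⟩
    simp only [Set.mem_insert_iff, Set.mem_singleton_iff, not_or] at hne
    refine ⟨s, hs0.lt_of_ne ?_, hs1.lt_of_ne ?_, rfl⟩
    · rintro rfl
      simp at hne
    · rintro rfl
      simp at hne
  · rintro ⟨s, hs0, hs1, rfl⟩
    refine ⟨⟨s, ⟨hs0.le, hs1.le⟩, rfl⟩, ?_⟩
    have hvu : v - u ≠ 0 := sub_ne_zero.2 huv.symm
    simp only [Set.mem_insert_iff, Set.mem_singleton_iff, not_or]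
    constructor <;> intro h
    · have : s • (v - u) = 0 := by
        rw [← sub_eq_zero] at h
        rw [← h]
        module
      exact (smul_ne_zero hs0.ne' hvu) this
    · have : (1 - s) • (v - u) = 0 := by
        rw [eq_comm, ← sub_eq_zero] at h
        rw [← h]
        module
      exact (smul_ne_zero (by linarith) hvu) this

lemma ne_of_mem_openSeg {V : Type*} [AddCommGroup V] [Module ℝ V] {u v x : V}
    (hx : x ∈ openSeg u v) : u ≠ v := by
  rintro rfl
  have h := hx.1
  rw [segment_same] at h
  exact hx.2 (Or.inl h)

section

variable {H : Submodule ℂ L2R} {h0 : fock 0 ∈ H} {N : ℕ}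

lemma not_injective_of_mem_generatorY (hdim : Module.finrank ℂ H = N + 1) {ρ₁ : Op H}
    (hρ₁ : ρ₁ ∈ generatorY h0 N) : ¬ Function.Injective ρ₁.toCLM :=
  not_injective_of_finrank_range hdim hρ₁.2.1

lemma rhoZero_ne_of_mem_generatorY {ρ₁ : Op H} (hρ₁ : ρ₁ ∈ generatorY h0 N) : rhoZero h0 ≠ ρ₁ := by
  rintro rfl
  refine hρ₁.2.2 ⟨⟨fock 0, h0⟩, ?_⟩
  change (inner ℂ (⟨fock 0, h0⟩ : H) (⟨fock 0, h0⟩ : H) : ℂ) • (⟨fock 0, h0⟩ : H) = _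
  have : (inner ℂ (⟨fock 0, h0⟩ : H) (⟨fock 0, h0⟩ : H) : ℂ) = 1 := by
    rw [inner_self_eq_norm_sq_to_K, show ‖(⟨fock 0, h0⟩ : H)‖ = 1 from norm_fock_zero]
    simp
  rw [this, one_smul]

variable [FiniteDimensional ℂ H]

/-- The points of the open ray between the vacuum state and an element of `Y(ℋ)` are invertible. -/
lemma injective_ray (hdim : Module.finrank ℂ H = N + 1) {ρ₁ : Op H} (hρ₁ : ρ₁ ∈ generatorY h0 N)
    {a b : ℝ} (ha : 0 < a) (hb : 0 < b) :
    Function.Injective (a • rhoZero h0 + b • ρ₁).toCLM :=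
  injective_smul_rankOne_add_smul hρ₁.1.1 hdim hρ₁.2.1 hρ₁.2.2 ha hb

/-- A ray from the vacuum state contains at most one element of `Y(ℋ)`. -/
lemma ray_unique (hdim : Module.finrank ℂ H = N + 1) {ρ₁ ρ₂ : Op H}
    (h₁ : ρ₁ ∈ generatorY h0 N) (h₂ : ρ₂ ∈ generatorY h0 N) {s t : ℝ} (hs : 0 < s) (ht : 0 < t)
    (h : (1 - s) • rhoZero h0 + s • ρ₁ = (1 - t) • rhoZero h0 + t • ρ₂) : ρ₁ = ρ₂ ∧ s = t := by
  -- the point closer to the vacuum would be invertible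
  have key {ρ₁ ρ₂ : Op H} (h₁ : ρ₁ ∈ generatorY h0 N) (h₂ : ρ₂ ∈ generatorY h0 N) {s t : ℝ}
      (hs : 0 < s) (ht : 0 < t)
      (h : (1 - s) • rhoZero h0 + s • ρ₁ = (1 - t) • rhoZero h0 + t • ρ₂) : s ≤ t := by
    by_contra! hst
    refine not_injective_of_mem_generatorY hdim h₁ ?_
    have he : ρ₁ = (s⁻¹ * (s - t)) • rhoZero h0 + (s⁻¹ * t) • ρ₂ := by
      have : ρ₁ = s⁻¹ • (((1 - s) • rhoZero h0 + s • ρ₁) - (1 - s) • rhoZero h0) := by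
        rw [add_sub_cancel_left, inv_smul_smul₀ hs.ne']
      rw [this, h]
      module
    rw [he]
    exact injective_ray hdim h₂ (mul_pos (inv_pos.2 hs) (sub_pos.2 hst))
      (mul_pos (inv_pos.2 hs) ht)
  obtain rfl := le_antisymm (key h₁ h₂ hs ht h) (key h₂ h₁ ht hs h.symm)
  exact ⟨smul_right_injective _ hs.ne' (add_left_cancel h), rfl⟩

namespace WignerQuotient

variable (D : WignerQuotient h0)

lemma isLeast_kZero (D : WignerQuotient h0) (hdim : Module.finrank ℂ H = N + 1) {ρ₁ : Op H}
    (hρ₁ : ρ₁ ∈ generatorY h0 N) : IsLeast (wignerRatios h0 ρ₁) (kZero h0 ρ₁) := by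
  obtain ⟨k, hk⟩ := D.exists_isLeast (D.leadCoeff_pos_of_mem_generatorY hdim hρ₁)
  rw [kZero, hk.csInf_eq]
  exact hk

lemma kZero_nonpos (D : WignerQuotient h0) (hdim : Module.finrank ℂ H = N + 1) {ρ₁ : Op H}
    (hρ₁ : ρ₁ ∈ generatorY h0 N) : kZero h0 ρ₁ ≤ 0 :=
  (D.isLeast_kZero hdim hρ₁).2 (Set.mem_insert _ _)

lemma kZero_le (hdim : Module.finrank ℂ H = N + 1) {ρ₁ : Op H} (hρ₁ : ρ₁ ∈ generatorY h0 N)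
    (z : ℝ × ℝ) : kZero h0 ρ₁ ≤ D.toFun z ρ₁ := by
  rw [← D.wigner_div]
  exact (D.isLeast_kZero hdim hρ₁).2 (Set.mem_insert_of_mem _ ⟨z, rfl⟩)

lemma kZero_eq (hdim : Module.finrank ℂ H = N + 1) {ρ₁ : Op H} (hρ₁ : ρ₁ ∈ generatorY h0 N) :
    kZero h0 ρ₁ = 0 ∨ ∃ z, D.toFun z ρ₁ = kZero h0 ρ₁ := by
  rcases (D.isLeast_kZero hdim hρ₁).1 with h | ⟨z, hz⟩
  · exact Or.inl h
  · exact Or.inr ⟨z, by rw [← D.wigner_div]; exact hz⟩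

lemma tZero_pos (D : WignerQuotient h0) (hdim : Module.finrank ℂ H = N + 1) {ρ₁ : Op H}
    (hρ₁ : ρ₁ ∈ generatorY h0 N) : 0 < tZero h0 ρ₁ := by
  have := D.kZero_nonpos hdim hρ₁
  exact one_div_pos.2 (by linarith)

lemma tZero_mul (D : WignerQuotient h0) (hdim : Module.finrank ℂ H = N + 1) {ρ₁ : Op H}
    (hρ₁ : ρ₁ ∈ generatorY h0 N) : tZero h0 ρ₁ * (1 - kZero h0 ρ₁) = 1 := by
  have := D.kZero_nonpos hdim hρ₁
  exact one_div_mul_cancel (by linarith)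

lemma tZero_le_one (D : WignerQuotient h0) (hdim : Module.finrank ℂ H = N + 1) {ρ₁ : Op H}
    (hρ₁ : ρ₁ ∈ generatorY h0 N) : tZero h0 ρ₁ ≤ 1 := by
  have h1 := D.kZero_nonpos hdim hρ₁
  have h2 := D.tZero_mul hdim hρ₁
  nlinarith [D.tZero_pos hdim hρ₁]

/-- The points of the ray before `F ρ₁` are in the core: they are invertible because the kernel of
`ρ₁` is not orthogonal to the vacuum, and their Wigner quotient is at least `1 - s (1 - k₀)`. -/
lemma ray_mem_core (hdim : Module.finrank ℂ H = N + 1) {ρ₁ : Op H} (hρ₁ : ρ₁ ∈ generatorY h0 N)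
    {s : ℝ} (hs : 0 < s) (hst : s < tZero h0 ρ₁) : (1 - s) • rhoZero h0 + s • ρ₁ ∈ D.core := by
  have hk := D.kZero_nonpos hdim hρ₁
  have ht := D.tZero_mul hdim hρ₁
  have hs1 : s < 1 := hst.trans_le (D.tZero_le_one hdim hρ₁)
  have hsk : s * (1 - kZero h0 ρ₁) < 1 :=
    (mul_lt_mul_of_pos_right hst (by linarith)).trans_eq ht
  refine ⟨convex_densityMatrices rhoZero_mem_densityMatrices hρ₁.1 (by linarith) hs.le (by ring),
    injective_ray (a := 1 - s) hdim hρ₁ (by linarith) hs, 1 - s * (1 - kZero h0 ρ₁), by linarith, fun z => ?_⟩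
  rw [toFun_combination, toFun_rhoZero]
  have := mul_le_mul_of_nonneg_left (D.kZero_le hdim hρ₁ z) hs.le
  linarith

/-- Every element of the core lies on a ray from the vacuum to an element of `Y(ℋ)`, closer to the
vacuum than the value of `F`. -/
lemma exists_ray_of_mem_core (hN : 0 < N) (hdim : Module.finrank ℂ H = N + 1) {ρ : Op H}
    (hρ : ρ ∈ D.core) : ∃ ρ₁ ∈ generatorY h0 N, ∃ s, 0 < s ∧ s < tZero h0 ρ₁ ∧ s < 1 ∧
      ρ = (1 - s) • rhoZero h0 + s • ρ₁ := by
  obtain ⟨⟨hpos, htr⟩, hinj, δ, hδ, hlow⟩ := hρ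
  have hu : (⟨fock 0, h0⟩ : H) ≠ 0 := by
    intro h
    have : ‖(⟨fock 0, h0⟩ : H)‖ = 1 := norm_fock_zero
    rw [h, norm_zero] at this
    exact zero_ne_one this
  obtain ⟨l, A, hl, hA, hrank, hnot, hdec⟩ := exists_sub_smul_rankOne hpos hinj hdim hu
  have htr' : (1 : ℂ) = l + LinearMap.trace ℂ H A.toLinearMap := by
    have h1 := trace_smul_add_smul (InnerProductSpace.rankOne ℂ (⟨fock 0, h0⟩ : H) ⟨fock 0, h0⟩)
      A l 1
    rw [trace_rankOne_self (u := (⟨fock 0, h0⟩ : H)) norm_fock_zero, Complex.ofReal_one, one_smul,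
      ← hdec, mul_one, one_mul] at h1
    rw [← h1]
    exact htr.symm
  have htrA : LinearMap.trace ℂ H A.toLinearMap = ((1 - l : ℝ) : ℂ) := by
    rw [Complex.ofReal_sub, Complex.ofReal_one]
    exact eq_sub_of_add_eq' htr'.symm
  have hl1 : 0 < 1 - l := by
    have h1 : 0 ≤ 1 - l := by
      have := trace_re_nonneg hA
      rwa [htrA, Complex.ofReal_re] at this
    refine h1.lt_of_ne fun h => ?_
    have hA0 : A = 0 := eq_zero_of_trace_re_eq_zero hA (by rw [htrA, Complex.ofReal_re, h])
    rw [hA0] at hrank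
    have : LinearMap.range (0 : H →L[ℂ] H).toLinearMap = ⊥ := LinearMap.range_zero
    rw [this, finrank_bot] at hrank
    omega
  set s := 1 - l with hs
  let A' : Op H := A
  have hsne : ((s⁻¹ : ℝ) : ℂ) ≠ 0 := by exact_mod_cast (inv_pos.2 hl1).ne'
  have hrange : LinearMap.range (s⁻¹ • A').toCLM.toLinearMap = LinearMap.range A.toLinearMap :=
    LinearMap.range_smul A.toLinearMap _ hsne
  have hY : s⁻¹ • A' ∈ generatorY h0 N := by
    refine ⟨⟨hA.smul_of_nonneg (Complex.zero_le_real.2 (inv_pos.2 hl1).le), ?_⟩, ?_, ?_⟩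
    · have : LinearMap.trace ℂ H (s⁻¹ • A').toCLM.toLinearMap =
          ((s⁻¹ : ℝ) : ℂ) * LinearMap.trace ℂ H A.toLinearMap :=
        (LinearMap.trace ℂ H).map_smul ((s⁻¹ : ℝ) : ℂ) A.toLinearMap
      rw [this, htrA, ← Complex.ofReal_mul, inv_mul_cancel₀ hl1.ne', Complex.ofReal_one]
    · rw [hrange]
      exact hrank
    · rw [hrange]
      exact hnot
  have hρ : ρ = (1 - s) • rhoZero h0 + s • s⁻¹ • A' := by
    rw [smul_inv_smul₀ hl1.ne', hs, sub_sub_cancel]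
    exact hdec
  refine ⟨s⁻¹ • A', hY, s, hl1, ?_, by linarith, hρ⟩
  -- the quotient of `ρ` is positive at the minimum of the quotient of the element of `Y(ℋ)`
  have hsk : s * (1 - kZero h0 (s⁻¹ • A')) < 1 := by
    rcases D.kZero_eq hdim hY with h | ⟨z, hz⟩
    · rw [h]
      linarith
    · have := hlow z
      rw [hρ, toFun_combination, toFun_rhoZero, hz] at this
      linarith
  rw [tZero, lt_div_iff₀ (by linarith [D.kZero_nonpos hdim hY])]
  exact hsk

/-- `F ρ₁` is not in the core: if `k₀ = 0` it is `ρ₁`, which is not invertible, and otherwise its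
Wigner function vanishes where the minimum `k₀` is attained. -/
lemma mapF_mem_frontier (hdim : Module.finrank ℂ H = N + 1) {ρ₁ : Op H}
    (hρ₁ : ρ₁ ∈ generatorY h0 N) : mapF h0 ρ₁ ∈ wignerPositive H \ D.core := by
  have ht0 := D.tZero_pos hdim hρ₁
  have ht1 := D.tZero_le_one hdim hρ₁
  have htk := D.tZero_mul hdim hρ₁
  refine ⟨D.mem_wignerPositive_iff.2 ⟨convex_densityMatrices rhoZero_mem_densityMatrices hρ₁.1
    (by linarith) ht0.le (by ring), fun z => ?_⟩, ?_⟩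
  · rw [mapF, toFun_combination, toFun_rhoZero]
    have := mul_le_mul_of_nonneg_left (D.kZero_le hdim hρ₁ z) ht0.le
    linarith
  · rintro ⟨-, hinj, δ, hδ, hlow⟩
    rcases D.kZero_eq hdim hρ₁ with h | ⟨z, hz⟩
    · have ht : tZero h0 ρ₁ = 1 := by rw [tZero, h]; norm_num
      rw [mapF, ht, sub_self, zero_smul, zero_add, one_smul] at hinj
      exact not_injective_of_mem_generatorY hdim hρ₁ hinj
    · have := hlow z
      rw [mapF, toFun_combination, toFun_rhoZero, hz] at this
      linarith

lemma rhoZero_ne_mapF (D : WignerQuotient h0) (hdim : Module.finrank ℂ H = N + 1) {ρ₁ : Op H}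
    (hρ₁ : ρ₁ ∈ generatorY h0 N) : rhoZero h0 ≠ mapF h0 ρ₁ := by
  intro h
  have h1 : tZero h0 ρ₁ • (ρ₁ - rhoZero h0) = 0 := by
    rw [eq_comm, ← sub_eq_zero] at h
    rw [← h, mapF]
    module
  exact smul_ne_zero (D.tZero_pos hdim hρ₁).ne'
    (sub_ne_zero.2 (rhoZero_ne_of_mem_generatorY hρ₁).symm) h1

/-- The open segment from the vacuum to `F ρ₁`, parametrized along the segment to `ρ₁`. -/
lemma mem_openSeg_mapF_iff (D : WignerQuotient h0) (hdim : Module.finrank ℂ H = N + 1)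
    {ρ ρ₁ : Op H} (hρ₁ : ρ₁ ∈ generatorY h0 N) : ρ ∈ openSeg (rhoZero h0) (mapF h0 ρ₁) ↔
      ∃ s, 0 < s ∧ s < tZero h0 ρ₁ ∧ ρ = (1 - s) • rhoZero h0 + s • ρ₁ := by
  have ht := D.tZero_pos hdim hρ₁
  rw [mem_openSeg_iff (D.rhoZero_ne_mapF hdim hρ₁)]
  constructor
  · rintro ⟨s, hs0, hs1, rfl⟩
    refine ⟨s * tZero h0 ρ₁, mul_pos hs0 ht, mul_lt_of_lt_one_left ht hs1, ?_⟩
    rw [mapF]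
    module
  · rintro ⟨s, hs0, hs1, rfl⟩
    refine ⟨s / tZero h0 ρ₁, div_pos hs0 ht, (div_lt_one ht).2 hs1, ?_⟩
    rw [mapF]
    match_scalars <;> field_simp
    ring

lemma injOn_mapF (D : WignerQuotient h0) (hdim : Module.finrank ℂ H = N + 1) :
    Set.InjOn (mapF h0) (generatorY h0 N) := fun _ h₁ _ h₂ h =>
  (ray_unique hdim h₁ h₂ (D.tZero_pos hdim h₁) (D.tZero_pos hdim h₂) h).1

lemma eq_of_mem_openSeg_mapF (D : WignerQuotient h0) (hdim : Module.finrank ℂ H = N + 1)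
    {ρ ρ₁ ρ₂ : Op H} (h₁ : ρ₁ ∈ generatorY h0 N) (h₂ : ρ₂ ∈ generatorY h0 N)
    (hm₁ : ρ ∈ openSeg (rhoZero h0) (mapF h0 ρ₁)) (hm₂ : ρ ∈ openSeg (rhoZero h0) (mapF h0 ρ₂)) :
    ρ₁ = ρ₂ := by
  obtain ⟨s, hs, -, h⟩ := (D.mem_openSeg_mapF_iff hdim h₁).1 hm₁
  obtain ⟨t, ht, -, h'⟩ := (D.mem_openSeg_mapF_iff hdim h₂).1 hm₂
  exact (ray_unique hdim h₁ h₂ hs ht (h.symm.trans h')).1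

/-- A ray from the vacuum through a point of the core leaves the set at one point only. -/
lemma frontier_unique {ρ p q : Op H} (hρ : ρ ∈ D.core) (hp : p ∈ wignerPositive H \ D.core)
    (hq : q ∈ wignerPositive H \ D.core) (hρp : ρ ∈ openSeg (rhoZero h0) p)
    (hρq : ρ ∈ openSeg (rhoZero h0) q) : p = q := by
  -- otherwise the closer of the two points would be between `ρ` and the other one
  have key {p q : Op H} (hp : p ∈ wignerPositive H \ D.core)
      (hq : q ∈ wignerPositive H \ D.core) {s t : ℝ} (hs0 : 0 < s) (hs1 : s < 1) (ht0 : 0 < t)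
      (ht1 : t < 1) (hρp : ρ = (1 - s) • rhoZero h0 + s • p)
      (hρq : ρ = (1 - t) • rhoZero h0 + t • q) : t ≤ s := by
    by_contra! hst
    refine hq.2 ?_
    have hs1' : 1 - s ≠ 0 := by linarith
    have hden : 0 < t * (1 - s) := mul_pos ht0 (by linarith)
    have h1 : q = t⁻¹ • (ρ - (1 - t) • rhoZero h0) := by
      rw [hρq, add_sub_cancel_left, inv_smul_smul₀ ht0.ne']
    have h2 : rhoZero h0 = (1 - s)⁻¹ • (ρ - s • p) := by
      rw [hρp, add_sub_cancel_right, inv_smul_smul₀ hs1']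
    have h3 : q = (s * (1 - t) / (t * (1 - s))) • p + ((t - s) / (t * (1 - s))) • ρ := by
      rw [h1, h2]
      match_scalars <;> field_simp
      ring
    rw [h3]
    refine D.combination_mem_core hp.1 hρ
      (div_nonneg (mul_nonneg hs0.le (by linarith)) hden.le) (div_pos (by linarith) hden) ?_
    field_simp
    ring
  obtain ⟨s, hs0, hs1, h⟩ := (mem_openSeg_iff (ne_of_mem_openSeg hρp)).1 hρp
  obtain ⟨t, ht0, ht1, h'⟩ := (mem_openSeg_iff (ne_of_mem_openSeg hρq)).1 hρq
  obtain rfl := le_antisymm (key hq hp ht0 ht1 hs0 hs1 h' h) (key hp hq hs0 hs1 ht0 ht1 h h')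
  exact smul_right_injective _ hs0.ne' (add_left_cancel (h.symm.trans h'))

lemma tZero_eq_traceNorm_div (D : WignerQuotient h0) (hdim : Module.finrank ℂ H = N + 1)
    {ρ₁ : Op H} (hρ₁ : ρ₁ ∈ generatorY h0 N) : tZero h0 ρ₁ =
      traceNorm (mapF h0 ρ₁ - rhoZero h0).toCLM / traceNorm (ρ₁ - rhoZero h0).toCLM := by
  have h1 : mapF h0 ρ₁ - rhoZero h0 = tZero h0 ρ₁ • (ρ₁ - rhoZero h0) := by
    rw [mapF]
    module
  have h2 : (mapF h0 ρ₁ - rhoZero h0).toCLM =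
      ((tZero h0 ρ₁ : ℝ) : ℂ) • (ρ₁ - rhoZero h0).toCLM := by
    rw [h1]
    rfl
  have h3 : traceNorm (ρ₁ - rhoZero h0).toCLM ≠ 0 :=
    traceNorm_ne_zero (sub_ne_zero.2 (rhoZero_ne_of_mem_generatorY hρ₁).symm)
  rw [h2, traceNorm_smul (D.tZero_pos hdim hρ₁).le, mul_div_cancel_right₀ _ h3]

lemma core_eq_iUnion (hN : 0 < N) (hdim : Module.finrank ℂ H = N + 1) :
    D.core = ⋃ ρ₁ ∈ generatorY h0 N, openSeg (rhoZero h0) (mapF h0 ρ₁) := by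
  ext ρ
  simp only [Set.mem_iUnion, exists_prop]
  constructor
  · intro hρ
    obtain ⟨ρ₁, hρ₁, s, hs0, hst, -, h⟩ := D.exists_ray_of_mem_core hN hdim hρ
    exact ⟨ρ₁, hρ₁, (D.mem_openSeg_mapF_iff hdim hρ₁).2 ⟨s, hs0, hst, h⟩⟩
  · rintro ⟨ρ₁, hρ₁, hρ⟩
    obtain ⟨s, hs0, hst, rfl⟩ := (D.mem_openSeg_mapF_iff hdim hρ₁).1 hρ
    exact D.ray_mem_core hdim hρ₁ hs0 hst

lemma wignerPositive_eq_closure_core : wignerPositive H = closure D.core := by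
  refine Set.Subset.antisymm (fun ρ hρ => ?_)
    (closure_minimal D.core_subset D.isClosed_wignerPositive)
  obtain ⟨κ, hκ⟩ := D.core_nonempty
  have hsub : openSegment ℝ ρ κ ⊆ D.core := by
    rintro _ ⟨a, b, ha, hb, hab, rfl⟩
    exact D.combination_mem_core hρ hκ ha.le hb hab
  exact closure_mono hsub (segment_subset_closure_openSegment (left_mem_segment ℝ ρ κ))

end WignerQuotient

end

end

theorem corollaryC18 (M N : ℕ) (H : Submodule ℂ L2R) [FiniteDimensional ℂ H]
    (hHM : H ≤ fockSpace M) (h0 : fock 0 ∈ H)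
    (hN : 0 < N) (hdim : Module.finrank ℂ H = N + 1) :
    -- the minimum that defines `F` is attained on `Y(ℋ)`
    (∀ ρ₁ ∈ generatorY h0 N, IsLeast (wignerRatios h0 ρ₁) (kZero h0 ρ₁)) ∧
    -- `F` is an injective map from `Y(ℋ)` to the relative boundary of `𝒟₊(ℋ)`
    Set.MapsTo (mapF h0) (generatorY h0 N) (intrinsicFrontier ℝ (wignerPositive H)) ∧
    Set.InjOn (mapF h0) (generatorY h0 N) ∧
    -- the formula for `t₀` in terms of trace norms
    (∀ ρ₁ ∈ generatorY h0 N, tZero h0 ρ₁ =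
      traceNorm (mapF h0 ρ₁ - rhoZero h0).toCLM / traceNorm (ρ₁ - rhoZero h0).toCLM) ∧
    -- for each point of the relative interior: the unique end points, which `F` relates
    (∀ ρ ∈ intrinsicInterior ℝ (wignerPositive H),
      (∃! ρ₁, ρ₁ ∈ generatorY h0 N ∧ ρ ∈ openSeg (rhoZero h0) ρ₁) ∧
      (∃! ρp, ρp ∈ intrinsicFrontier ℝ (wignerPositive H) ∧ ρ ∈ openSeg (rhoZero h0) ρp) ∧
      (∀ ρ₁ ρp, ρ₁ ∈ generatorY h0 N → ρ ∈ openSeg (rhoZero h0) ρ₁ →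
        ρp ∈ intrinsicFrontier ℝ (wignerPositive H) → ρ ∈ openSeg (rhoZero h0) ρp →
        ρp = mapF h0 ρ₁)) ∧
    -- the relative interior is the union of the open segments
    intrinsicInterior ℝ (wignerPositive H) =
      ⋃ ρ₁ ∈ generatorY h0 N, openSeg (rhoZero h0) (mapF h0 ρ₁) ∧
    intrinsicInterior ℝ (wignerPositive H) =
      ⋃ ρp ∈ generatorX h0 N, openSeg (rhoZero h0) ρp ∧
    -- every segment is nonempty
    (∀ ρ₁ ∈ generatorY h0 N, (openSeg (rhoZero h0) (mapF h0 ρ₁)).Nonempty) ∧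
    (∀ ρp ∈ generatorX h0 N, (openSeg (rhoZero h0) ρp).Nonempty) ∧
    -- the segments are pairwise disjoint, and each interior point lies on exactly one of them
    (generatorY h0 N).PairwiseDisjoint (fun ρ₁ => openSeg (rhoZero h0) (mapF h0 ρ₁)) ∧
    (generatorX h0 N).PairwiseDisjoint (fun ρp => openSeg (rhoZero h0) ρp) ∧
    (∀ ρ ∈ intrinsicInterior ℝ (wignerPositive H),
      ∃! ρ₁, ρ₁ ∈ generatorY h0 N ∧ ρ ∈ openSeg (rhoZero h0) (mapF h0 ρ₁)) ∧
    (∀ ρ ∈ intrinsicInterior ℝ (wignerPositive H),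
      ∃! ρp, ρp ∈ generatorX h0 N ∧ ρ ∈ openSeg (rhoZero h0) ρp) ∧
    -- `𝒟₊(ℋ)` is the closure of the union
    wignerPositive H = closure (⋃ ρp ∈ generatorX h0 N, openSeg (rhoZero h0) ρp) := by
  obtain ⟨D⟩ := exists_wignerQuotient hHM h0 (by omega)
  have hunion : ⋃ ρp ∈ generatorX h0 N, openSeg (rhoZero h0) ρp =
      ⋃ ρ₁ ∈ generatorY h0 N, openSeg (rhoZero h0) (mapF h0 ρ₁) := Set.biUnion_image
  have hne (ρ₁ : Op H) (hρ₁ : ρ₁ ∈ generatorY h0 N) :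
      (openSeg (rhoZero h0) (mapF h0 ρ₁)).Nonempty :=
    ⟨_, (D.mem_openSeg_mapF_iff hdim hρ₁).2 ⟨tZero h0 ρ₁ / 2, half_pos (D.tZero_pos hdim hρ₁),
      half_lt_self (D.tZero_pos hdim hρ₁), rfl⟩⟩
  rw [D.intrinsicInterior_eq, D.intrinsicFrontier_eq, hunion, ← D.core_eq_iUnion hN hdim]
  refine ⟨fun ρ₁ hρ₁ => D.isLeast_kZero hdim hρ₁, fun ρ₁ hρ₁ => D.mapF_mem_frontier hdim hρ₁,
    D.injOn_mapF hdim, fun ρ₁ hρ₁ => D.tZero_eq_traceNorm_div hdim hρ₁, fun ρ hρ => ?_, rfl, rfl,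
    hne, ?_, ?_, ?_, fun ρ hρ => ?_, fun ρ hρ => ?_, D.wignerPositive_eq_closure_core⟩
  · obtain ⟨ρ₁, hρ₁, s, hs0, hst, hs1, h⟩ := D.exists_ray_of_mem_core hN hdim hρ
    have hF : ρ ∈ openSeg (rhoZero h0) (mapF h0 ρ₁) :=
      (D.mem_openSeg_mapF_iff hdim hρ₁).2 ⟨s, hs0, hst, h⟩
    have huniq (ρ₂ : Op H) (hρ₂ : ρ₂ ∈ generatorY h0 N) (hρ : ρ ∈ openSeg (rhoZero h0) ρ₂) :
        ρ₂ = ρ₁ := by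
      obtain ⟨t, ht0, -, h'⟩ := (mem_openSeg_iff (rhoZero_ne_of_mem_generatorY hρ₂)).1 hρ
      exact (ray_unique hdim hρ₂ hρ₁ ht0 hs0 (h'.symm.trans h)).1
    refine ⟨⟨ρ₁, ⟨hρ₁, (mem_openSeg_iff (rhoZero_ne_of_mem_generatorY hρ₁)).2
        ⟨s, hs0, hs1, h⟩⟩, fun ρ₂ h₂ => huniq ρ₂ h₂.1 h₂.2⟩,
      ⟨mapF h0 ρ₁, ⟨D.mapF_mem_frontier hdim hρ₁, hF⟩,
        fun p hp => D.frontier_unique hρ hp.1 (D.mapF_mem_frontier hdim hρ₁) hp.2 hF⟩,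
      fun ρ₂ p hρ₂ h₂ hp hρp => ?_⟩
    rw [huniq ρ₂ hρ₂ h₂]
    exact D.frontier_unique hρ hp (D.mapF_mem_frontier hdim hρ₁) hρp hF
  · rintro _ ⟨ρ₁, hρ₁, rfl⟩
    exact hne ρ₁ hρ₁
  · intro ρ₁ h₁ ρ₂ h₂ h
    exact Set.disjoint_left.2 fun ρ hm₁ hm₂ => h (D.eq_of_mem_openSeg_mapF hdim h₁ h₂ hm₁ hm₂)
  · rintro _ ⟨ρ₁, h₁, rfl⟩ _ ⟨ρ₂, h₂, rfl⟩ h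
    exact Set.disjoint_left.2 fun ρ hm₁ hm₂ =>
      h (congrArg _ (D.eq_of_mem_openSeg_mapF hdim h₁ h₂ hm₁ hm₂))
  · rw [D.core_eq_iUnion hN hdim] at hρ
    simp only [Set.mem_iUnion, exists_prop] at hρ
    obtain ⟨ρ₁, hρ₁, hm⟩ := hρ
    exact ⟨ρ₁, ⟨hρ₁, hm⟩, fun ρ₂ h₂ => D.eq_of_mem_openSeg_mapF hdim h₂.1 hρ₁ h₂.2 hm⟩
  · rw [D.core_eq_iUnion hN hdim] at hρ
    simp only [Set.mem_iUnion, exists_prop] at hρ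
    obtain ⟨ρ₁, hρ₁, hm⟩ := hρ
    refine ⟨mapF h0 ρ₁, ⟨⟨ρ₁, hρ₁, rfl⟩, hm⟩, ?_⟩
    rintro _ ⟨⟨ρ₂, hρ₂, rfl⟩, hm₂⟩
    exact congrArg _ (D.eq_of_mem_openSeg_mapF hdim hρ₂ hρ₁ hm₂ hm)
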